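/- **Setting.** An object specification $\Delta$ consists of a finite set $S$ of local states, a finite set of actions, and for each $c\in S$ a finite set of transitions $c\xrightarrow{a}c'$, where different transitions of $c$ carry different actions. Let $U^S$ be the unit simplex in $\mathbb R^S$. A system specification of size $N\ge 1$ adds to $\Delta$ an initial global state $C_0^{(N)}\in S^N$ and, for every action $a$, an expression $E_a^{(N)}$ built from constants in $[0,1]$, the fractions $\mathsf{frc}\,c$ ($c\in S$) and unary and binary real operations; its value at $m\in U^S$, with $\mathsf{frc}\,c$ read as $m_c$, is $\pi^{(N)}(m,a)$. Every local state is assumed probabilistic at every $m\in U^S$: for each $c$, the values $\pi^{(N)}(m,a)$ of the actions $a$ of its transitions are nonnegative and have sum at most $1$. The object transition matrix is $K^{(N)}(m)_{c,c'}=\sum_{a:\,c\xrightarrow{a}c'}\pi^{(N)}(m,a)$ for $c\ne c'$, the diagonal being such that rows sum to $1$. For $C\in S^N$ let $M^{(N)}(C)\in U^S$ be its occupancy measure (the fractions of objects in each local state). The full system chain $\mathcal D^{(N)}$ is the Markov chain on $S^N$ started in $C_0^{(N)}$, with transition probabilities $\prod_{n=1}^N K^{(N)}(M^{(N)}(C))_{C_{[n]},C'_{[n]}}$.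 **Labels.** Each local state $c$ has a set $\ell_1(c)$ of local atomic propositions. Each global atomic proposition $a$ is given by an expression $F_a(\mathsf{frc}\,c_1,\dots,\mathsf{frc}\,c_q)\bowtie r_a$ with $F_a$ continuous on $[0,1]^q$ and $\bowtie\,\in\{<,>\}$; write $F_a(m)$ for $F_a(m_{c_1},\dots,m_{c_q})$. The state $C$ of $\mathcal D^{(N)}$ has the label set $\ell_1(C_{[1]})$ together with the global propositions true at $M^{(N)}(C)$; a pair $\langle c,m\rangle$ has the label set $\ell_1(c)$ together with the global propositions true at $m$. **Logic.** Formulas are those of time-bounded PCTL, $\Phi::=a\mid\neg\Phi\mid\Phi\vee\Phi\mid \mathbb P_{\bowtie p}(\varphi)$ with $\bowtie\,\in\{\ge,>,\le,<\}$, and $\varphi::=\mathsf X\,\Phi\mid\Phi\,\mathcal U^{\le k}\,\Phi$, with the usual semantics over labelled Markov chains. **Assumptions.** The specifications for $N\ge N_0$ share $\Delta$, the labelling and the initial local state $c_0$ of the first object. There is $K$, continuous on $U^S$, such that $K^{(N)}(m)_{c,c'}\to K(m)_{c,c'}$ uniformly in $m\in U^S$ for all $c,c'\in S$, and $M^{(N)}(C_0^{(N)})\to\mu_0\in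 U^S$. Put $\mu(0)=\mu_0$ and $\mu(t+1)=\mu(t)\cdot K(\mu(t))$. The limit chain $\mathcal{HD}$ on $S\times U^S$ starts in $\langle c_0,\mu_0\rangle$ and moves from $\langle c,m\rangle$ to $\langle c',m\cdot K(m)\rangle$ with probability $K(m)_{c,c'}$. For $N\ge N_0$ let $X^{(N)}$ be Markov chains with the law of $\mathcal D^{(N)}$, all defined on one probability space, with arbitrary joint law over the different $N$. **Statement.** Let $t\in\mathbb N$ and let $\Phi$ be a formula such that 1. ($\Phi$ is safe) for every subformula $\mathbb P_{\bowtie p}(\varphi)$ of $\Phi$, every $c\in S$ and every $s\in\mathbb N$, the probability in $\mathcal{HD}$ that a path from $\langle c,\mu(s)\rangle$ satisfies $\varphi$ is different from $p$; 2. for every global atomic proposition $a$ that occurs in $\Phi$ and every $s\ge t$, $F_a(\mu(s))\neq r_a$. Then almost surely there is $\bar N$ such that for all $N\ge\bar N$ the random global state $C^{(N)}=X^{(N)}(t)$ is reachable at time $t$ in $\mathcal D^{(N)}$ (it is visited at time $t$ by a path from $C_0^{(N)}$ with steps of positive probability), and $$C^{(N)}\models_{\mathcal D^{(N)}}\Phi\quad\Longleftrightarrow\quad\langle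 C^{(N)}_{[1]},\mu(t)\rangle\models_{\mathcal{HD}}\Phi .$$ -/

import Mathlib

open MeasureTheory ProbabilityTheory Filter Topology

noncomputable section

universe u

/-! ## Time-bounded PCTL over state-labelled discrete-time Markov chains -/

/-- The four comparison symbols allowed in the probability operator. -/
inductive Cmp : Type
  | ge | gt | le | lt

/-- Meaning of a comparison symbol. -/
def Cmp.Holds : Cmp → ℝ → ℝ → Prop
  | .ge, x, y => x ≥ y
  | .gt, x, y => x > y
  | .le, x, y => x ≤ y
  | .lt, x, y => x < y

mutual

/-- State formulas of time-bounded PCTL over the atomic propositions `AP`: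
`a`, `¬ Φ`, `Φ ∨ Ψ`, `P_{⋈ p}(φ)`. -/
inductive StateFormula (AP : Type u) : Type u
  | atom (a : AP) : StateFormula AP
  | neg (Φ : StateFormula AP) : StateFormula AP
  | or (Φ Ψ : StateFormula AP) : StateFormula AP
  | prob (b : Cmp) (p : ℝ) (φ : PathFormula AP) : StateFormula AP

/-- Path formulas: `X Φ` and `Φ U^{≤ k} Ψ`. -/
inductive PathFormula (AP : Type u) : Type u
  | nxt (Φ : StateFormula AP) : PathFormula AP
  | untl (k : ℕ) (Φ Ψ : StateFormula AP) : PathFormula AP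

end

mutual

/-- The set of state subformulas of a state formula (the formula itself included). -/
def StateFormula.subformulas {AP : Type*} : StateFormula AP → Set (StateFormula AP)
  | .atom a => {.atom a}
  | .neg Φ => {.neg Φ} ∪ Φ.subformulas
  | .or Φ Ψ => {.or Φ Ψ} ∪ (Φ.subformulas ∪ Ψ.subformulas)
  | .prob b p φ => {.prob b p φ} ∪ φ.subformulas

/-- The set of state subformulas of a path formula. -/
def PathFormula.subformulas {AP : Type*} : PathFormula AP → Set (StateFormula AP)
  | .nxt Φ => Φ.subformulas
  | .untl _ Φ Ψ => Φ.subformulas ∪ Ψ.subformulas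

end

/-- A state-labelled discrete-time Markov chain with an initial state. The row of the one-step
matrix at `s` is the probability mass function `step s`, so the matrix entry at `(s, s')` is
`step s s'`. -/
structure LabelledDTMC (State AP : Type*) where
  init : State
  step : State → PMF State
  label : State → Set AP

namespace LabelledDTMC

variable {State AP : Type*} (M : LabelledDTMC State AP)

/-- The infinite paths starting in `s`: every step has positive probability. -/
def Paths (s : State) : Set (ℕ → State) :=
  {σ | σ 0 = s ∧ ∀ i, 0 < M.step (σ i) (σ (i + 1))}

/-- The states that the paths from the initial state visit at time `t`. -/
def reachable (t : ℕ) : Set State :=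
  {s | ∃ σ ∈ M.Paths M.init, σ t = s}

/-- The one-step matrix as a Markov kernel; the state space carries the discrete σ-algebra. -/
def stepKernel : @Kernel State State ⊤ ⊤ :=
  letI : MeasurableSpace State := ⊤
  { toFun := fun s => (M.step s).toMeasure
    measurable' := measurable_from_top }

theorem isMarkovKernel_stepKernel : @IsMarkovKernel State State ⊤ ⊤ M.stepKernel :=
  letI : MeasurableSpace State := ⊤
  ⟨fun s => PMF.toMeasure.isProbabilityMeasure (M.step s)⟩

/-- The law on the space of infinite sequences (with the product of the discrete σ-algebras) of
the chain started in `s`, by the Ionescu-Tulcea theorem. -/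
def pathMeasure (s : State) :
    @Measure (ℕ → State) (@MeasurableSpace.pi ℕ (fun _ => State) (fun _ => ⊤)) :=
  letI : MeasurableSpace State := ⊤
  haveI := M.isMarkovKernel_stepKernel
  Kernel.traj (X := fun _ : ℕ => State)
    (fun n => M.stepKernel.comap
      (fun x : (i : Finset.Iic n) → State => x ⟨n, Finset.mem_Iic.2 le_rfl⟩)
      (measurable_pi_apply _)) 0 (fun _ => s)

/-- `Pr {σ ∈ Paths(s) | σ ∈ E}`. -/
def pathProb (s : State) (E : Set (ℕ → State)) : ℝ :=
  (M.pathMeasure s (M.Paths s ∩ E)).toReal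

mutual

/-- Satisfaction of a state formula in a state. -/
def Sat : StateFormula AP → State → Prop
  | .atom a, s => a ∈ M.label s
  | .neg Φ, s => ¬ Sat Φ s
  | .or Φ Ψ, s => Sat Φ s ∨ Sat Ψ s
  | .prob b p φ, s => b.Holds (M.pathProb s {σ | PathSat φ σ}) p

/-- Satisfaction of a path formula on a sequence of states. -/
def PathSat : PathFormula AP → (ℕ → State) → Prop
  | .nxt Φ, σ => Sat Φ (σ 1)
  | .untl k Φ Ψ, σ => ∃ h ≤ k, Sat Ψ (σ h) ∧ ∀ i < h, Sat Φ (σ i)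

end

/-- `Φ` is safe on the set `Q` of states: for every subformula `P_{⋈ p}(φ)` of `Φ`, the
probability of `φ` differs from `p` in each state of `Q`. -/
def SafeOn (Q : Set State) (Φ : StateFormula AP) : Prop :=
  ∀ (b : Cmp) (p : ℝ) (φ : PathFormula AP), .prob b p φ ∈ Φ.subformulas →
    ∀ s ∈ Q, M.pathProb s {σ | M.PathSat φ σ} ≠ p

/-- `X` is, on the probability space `(Ω, P)`, a Markov chain with the one-step matrix of `M`,
started in the initial state of `M` (for a countable state space). -/
structure IsRealization {Ω : Type*} [MeasurableSpace Ω] (P : Measure Ω)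
    (X : ℕ → Ω → State) : Prop where
  measurable : ∀ t s, MeasurableSet {ω | X t ω = s}
  initial : ∀ᵐ ω ∂P, X 0 ω = M.init
  markov : ∀ (t : ℕ) (x : ℕ → State),
    P {ω | ∀ i ≤ t + 1, X i ω = x i} =
      P {ω | ∀ i ≤ t, X i ω = x i} * M.step (x t) (x (t + 1))

end LabelledDTMC

/-! ## The population language -/

/-- An object specification with (finite) set of state constants `S` and set of actions `Act`:
the state definition of `c` is `c := ∑ a.c'` over the pairs `(a, c') ∈ summands c`, and the
actions of different summands of a definition differ. The labelled transition system has
`c --a--> c'` iff `(a, c') ∈ summands c`. -/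
structure ObjectSpec (S Act : Type*) where
  summands : S → Finset (Act × S)
  action_unique : ∀ c a c₁ c₂, (a, c₁) ∈ summands c → (a, c₂) ∈ summands c → c₁ = c₂

/-- Expressions in probability function definitions: constants in `[0,1]`, fractions `frc C`,
and unary and binary operators on the reals. -/
inductive PExp (S : Type*) : Type _
  | const (v : unitInterval) : PExp S
  | frc (c : S) : PExp S
  | unary (op : ℝ → ℝ) (E : PExp S) : PExp S
  | binary (op : ℝ → ℝ → ℝ) (E₁ E₂ : PExp S) : PExp S

/-- Value of an expression at a point of the unit simplex. -/
def PExp.eval {S : Type*} [Fintype S] : PExp S → stdSimplex ℝ S → ℝ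
  | .const v, _ => v
  | .frc c, m => m.1 c
  | .unary op E, m => op (E.eval m)
  | .binary op E₁ E₂, m => op (E₁.eval m) (E₂.eval m)

/-- A real square matrix is (row-)stochastic. -/
structure IsStochastic {S : Type*} [Fintype S] (Q : Matrix S S ℝ) : Prop where
  nonneg : ∀ c c', 0 ≤ Q c c'
  row_sum : ∀ c, ∑ c', Q c c' = 1

/-- The row of a stochastic matrix as a probability mass function. -/
def IsStochastic.row {S : Type*} [Fintype S] {Q : Matrix S S ℝ} (h : IsStochastic Q) (c : S) :
    PMF S :=
  PMF.ofFintype (fun c' => ENNReal.ofReal (Q c c')) (by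
    rw [← ENNReal.ofReal_sum_of_nonneg fun c' _ => h.nonneg c c', h.row_sum, ENNReal.ofReal_one])

section Population

variable {S Act : Type*} [Fintype S] [DecidableEq S] [Fintype Act] [DecidableEq Act]

namespace ObjectSpec

variable (Δ : ObjectSpec S Act)

/-- `I(c)`: the actions that lead from `c` to a different state. -/
def leaving (c : S) : Finset Act :=
  {a | ∃ c', (a, c') ∈ Δ.summands c ∧ c' ≠ c}

/-- `I*(c)`: the actions of `I(c)` and those that label a loop at `c`. -/
def enabled (c : S) : Finset Act :=
  Δ.leaving c ∪ ({a | (a, c) ∈ Δ.summands c} : Finset Act)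

/-- The object transition matrix at `m`, where `A a` is the expression assigned to `a`. -/
def objectMatrix (A : Act → PExp S) (m : stdSimplex ℝ S) : Matrix S S ℝ :=
  fun c c' =>
    if c ≠ c' then ∑ a with (a, c') ∈ Δ.summands c, (A a).eval m
    else 1 - ∑ a ∈ Δ.leaving c, (A a).eval m

/-- The state `c` is probabilistic in `m`: the values of the enabled actions are nonnegative and
add up to at most `1`. -/
def IsProbabilistic (A : Act → PExp S) (m : stdSimplex ℝ S) (c : S) : Prop :=
  (∀ a ∈ Δ.enabled c, 0 ≤ (A a).eval m) ∧ ∑ a ∈ Δ.enabled c, (A a).eval m ≤ 1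

theorem isStochastic_objectMatrix {A : Act → PExp S} {m : stdSimplex ℝ S}
    (h : ∀ c, Δ.IsProbabilistic A m c) : IsStochastic (Δ.objectMatrix A m) := by
  have hsub : ∀ c, Δ.leaving c ⊆ Δ.enabled c := fun c => Finset.subset_union_left
  refine ⟨fun c c' => ?_, fun c => ?_⟩
  · unfold objectMatrix
    split_ifs with hc
    · refine Finset.sum_nonneg fun a ha => (h c).1 a (hsub c ?_)
      simp only [Finset.mem_filter, Finset.mem_univ, true_and] at ha
      simp only [leaving, Finset.mem_filter, Finset.mem_univ, true_and]
      exact ⟨c', ha, fun e => hc e.symm⟩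
    · have := Finset.sum_le_sum_of_subset_of_nonneg (f := fun a => (A a).eval m) (hsub c)
        (fun a ha _ => (h c).1 a ha)
      linarith [(h c).2]
  · rw [← Finset.add_sum_erase _ _ (Finset.mem_univ c)]
    have h1 : ∑ c' ∈ Finset.univ.erase c, Δ.objectMatrix A m c c'
        = ∑ a ∈ Δ.leaving c, (A a).eval m := by
      have h2 : Δ.leaving c = (Finset.univ.erase c).biUnion
          (fun c' => ({a | (a, c') ∈ Δ.summands c} : Finset Act)) := by
        ext a
        simp only [leaving, Finset.mem_filter, Finset.mem_univ, true_and, Finset.mem_biUnion,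
          Finset.mem_erase, and_true]
        exact ⟨fun ⟨x, y, z⟩ => ⟨x, z, y⟩, fun ⟨x, y, z⟩ => ⟨x, z, y⟩⟩
      rw [h2, Finset.sum_biUnion]
      · refine Finset.sum_congr rfl fun c' hc' => ?_
        have : c ≠ c' := fun e => (Finset.ne_of_mem_erase hc') e.symm
        simp [objectMatrix, this]
      · intro c₁ _ c₂ _ h12
        refine Finset.disjoint_left.2 fun a h1 h2 => h12 ?_
        simp only [Finset.mem_filter, Finset.mem_univ, true_and] at h1 h2
        exact Δ.action_unique c a c₁ c₂ h1 h2
    rw [h1]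
    simp [objectMatrix]

end ObjectSpec

/-- The occupancy measure of a global state of a population of `N ≥ 1` objects. -/
def occupancy {N : ℕ} [NeZero N] (C : Fin N → S) : stdSimplex ℝ S :=
  ⟨fun c => (1 / (N : ℝ)) * ∑ n, if C n = c then 1 else 0, by
    refine ⟨fun c => by positivity, ?_⟩
    rw [← Finset.mul_sum, Finset.sum_comm]
    have : (N : ℝ) ≠ 0 := Nat.cast_ne_zero.2 (NeZero.ne N)
    simp [this]⟩

/-- A system specification `⟨Δ, A, C₀⟩` of size `N`, in which every state is probabilistic in
every point of the unit simplex. -/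
structure SystemSpec (Δ : ObjectSpec S Act) (N : ℕ) where
  A : Act → PExp S
  C₀ : Fin N → S
  probabilistic : ∀ m c, Δ.IsProbabilistic A m c

/-- Basic boolean expressions `F(frc C₁, …, frc C_q) ⋈ r`, where `F` is continuous on `[0,1]^q`
and `⋈` is `>` (if `isGt`) or `<` (otherwise). -/
structure BExp (S : Type*) where
  q : ℕ
  F : (Fin q → ℝ) → ℝ
  continuousOn : ContinuousOn F (Set.Icc 0 1)
  args : Fin q → S
  isGt : Bool
  r : ℝ

/-- The value of `F(frc C₁, …, frc C_q)` at `m`. -/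
def BExp.value (e : BExp S) (m : stdSimplex ℝ S) : ℝ := e.F fun j => m.1 (e.args j)

/-- The truth of the boolean expression at `m`. -/
def BExp.Holds (e : BExp S) (m : stdSimplex ℝ S) : Prop :=
  if e.isGt then e.value m > e.r else e.value m < e.r

/-- State labelling definitions: the local propositions of each local state, and the boolean
expression of each global proposition. -/
structure Labelling (S AP₁ APg : Type*) where
  loc : S → Set AP₁
  glob : APg → BExp S

/-- The label set `ℓ₁(c) ∪ ℓ_g(m)`. -/
def Labelling.labels {AP₁ APg : Type*} (ℓ : Labelling S AP₁ APg) (c : S) (m : stdSimplex ℝ S) :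
    Set (AP₁ ⊕ APg) :=
  Sum.inl '' ℓ.loc c ∪ Sum.inr '' {a | (ℓ.glob a).Holds m}

namespace SystemSpec

variable {Δ : ObjectSpec S Act} {N : ℕ}

/-- The object transition matrix of the specification. -/
def K (spec : SystemSpec Δ N) (m : stdSimplex ℝ S) : Matrix S S ℝ := Δ.objectMatrix spec.A m

theorem isStochastic_K (spec : SystemSpec Δ N) (m : stdSimplex ℝ S) : IsStochastic (spec.K m) :=
  Δ.isStochastic_objectMatrix (spec.probabilistic m)

/-- The one-step matrix of the system: from `C`, the `N` objects move independently, each with the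
object transition matrix at the occupancy measure of `C`. -/
def systemMatrix [NeZero N] (spec : SystemSpec Δ N) : Matrix (Fin N → S) (Fin N → S) ℝ :=
  fun C C' => ∏ n, spec.K (occupancy C) (C n) (C' n)

theorem isStochastic_systemMatrix [NeZero N] (spec : SystemSpec Δ N) :
    IsStochastic spec.systemMatrix where
  nonneg C C' := Finset.prod_nonneg fun n _ => (spec.isStochastic_K _).nonneg _ _
  row_sum C := by
    unfold systemMatrix
    rw [← Fintype.piFinset_univ,
      ← Finset.prod_univ_sum (fun _ => Finset.univ) (fun n c' => spec.K (occupancy C) (C n) c')]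
    exact Finset.prod_eq_one fun n _ => (spec.isStochastic_K _).row_sum _

/-- The labelled chain `D^(N)` of the full system. -/
def fullChain [NeZero N] {AP₁ APg : Type*} (spec : SystemSpec Δ N) (ℓ : Labelling S AP₁ APg) :
    LabelledDTMC (Fin N → S) (AP₁ ⊕ APg) where
  init := spec.C₀
  step C := spec.isStochastic_systemMatrix.row C
  label C := ℓ.labels (C 0) (occupancy C)

end SystemSpec

end Population

/-! ## The mean-field limit -/

section MeanField

variable {S : Type*} [Fintype S]

/-- The map `m ↦ m · K(m)` on the unit simplex, for a matrix function with stochastic values. -/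
def meanFieldStep (K : stdSimplex ℝ S → Matrix S S ℝ) (hK : ∀ m, IsStochastic (K m))
    (m : stdSimplex ℝ S) : stdSimplex ℝ S :=
  ⟨fun c' => ∑ c, m.1 c * K m c c', by
    refine ⟨fun c' => Finset.sum_nonneg fun c _ => mul_nonneg (m.2.1 c) ((hK m).nonneg _ _), ?_⟩
    rw [Finset.sum_comm]
    simp only [← Finset.mul_sum, (hK m).row_sum, mul_one]
    exact m.2.2⟩

/-- `μ(0) = μ₀` and `μ(t+1) = μ(t) · K(μ(t))`. -/
def meanField (K : stdSimplex ℝ S → Matrix S S ℝ) (hK : ∀ m, IsStochastic (K m))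
    (μ₀ : stdSimplex ℝ S) : ℕ → stdSimplex ℝ S
  | 0 => μ₀
  | t + 1 => meanFieldStep K hK (meanField K hK μ₀ t)

/-- The labelled limit chain `HD`, with initial state `⟨c₀, μ₀⟩`: from `⟨c, m⟩` it moves to
`⟨c', m · K(m)⟩` with probability `K(m)_{c,c'}`. -/
def limitChain {AP₁ APg : Type*} (K : stdSimplex ℝ S → Matrix S S ℝ)
    (hK : ∀ m, IsStochastic (K m)) (c₀ : S) (μ₀ : stdSimplex ℝ S) (ℓ : Labelling S AP₁ APg) :
    LabelledDTMC (S × stdSimplex ℝ S) (AP₁ ⊕ APg) where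
  init := (c₀, μ₀)
  step x := ((hK x.2).row x.1).map fun c' => (c', meanFieldStep K hK x.2)
  label x := ℓ.labels x.1 x.2

/-- A pointwise limit of stochastic matrices is stochastic. -/
theorem isStochastic_of_tendsto {ι : Type*} {l : Filter ι} [l.NeBot] {Q : ι → Matrix S S ℝ}
    {R : Matrix S S ℝ} (hQ : ∀ i, IsStochastic (Q i))
    (h : ∀ c c', Tendsto (fun i => Q i c c') l (𝓝 (R c c'))) : IsStochastic R where
  nonneg c c' := ge_of_tendsto' (h c c') fun i => (hQ i).nonneg c c'
  row_sum c := tendsto_nhds_unique (tendsto_finsetSum _ fun c' _ => h c c') (by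
    simp only [(hQ _).row_sum]
    exact tendsto_const_nhds)

/-- A uniform limit of the object transition matrices of specifications of growing size is
stochastic at every point of the unit simplex. -/
theorem isStochastic_limit {Act : Type*} [DecidableEq S] [Fintype Act] [DecidableEq Act]
    {Δ : ObjectSpec S Act} {spec : (N : ℕ+) → SystemSpec Δ N} {K : stdSimplex ℝ S → Matrix S S ℝ}
    (h : ∀ c c', TendstoUniformly (fun (N : ℕ+) m => (spec N).K m c c') (fun m => K m c c') atTop)
    (m : stdSimplex ℝ S) : IsStochastic (K m) :=
  isStochastic_of_tendsto (l := atTop) (fun N : ℕ+ => (spec N).isStochastic_K m)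
    fun c c' => (h c c').tendsto_at m

end MeanField

end

/-!
The argument compares the two chains from states near the mean field, whatever the way in which
these states are reached. Let `largeNear m` be the filter on global states of all sizes along which
the number of objects tends to infinity and the occupancy measure tends to `m`. By induction on the
formula, for every `s ≥ t` and eventually along `largeNear (μ s)`, the truth of the formula in a
global state `C` of the full system is its truth in `(C 0, μ s)` in the limit chain
(`eventually_sat_iff`).

* For a global proposition this is the continuity of its expression, since `μ s` is not on the
  boundary.
* For `P_{⋈ p}(φ)` the probability of `φ` from `C` minus that from `(C 0, μ s)` tends to zero
  (`tendsto_pathProb`); as the latter takes finitely many values, all different from `p`, the two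
  are finally on the same side of `p`. The event of an until formula is split by the first time at
  which its goal holds, and the probability of each part is an iterate of the operator
  `f ↦ 1_A · E[f(next state)]` (`LabelledDTMC.pathMeasure_box`), so only one-step means have to be
  compared (`tendsto_mean_largeNear`): the first object moves with its own row of `K^(N)`, which
  converges uniformly to the continuous `K`, and the next occupancy measure is near `μ (s + 1)` with
  probability tending to one.

The last fact comes with an exponential rate in the number of objects, by a Chernoff bound for the
independent moves of the objects (`exists_sum_systemMatrix_filter_le`). The rate is summable, so by
the Borel–Cantelli lemma and induction on time the occupancy measure of `X^(N)(t)` almost surely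
converges to `μ t`, with no condition on the joint law for different `N`
(`ae_eventually_occupancy_mem`). Hence almost surely the equivalence applies to `X^(N)(t)` for all
large `N`. The trajectory of `X^(N)` itself is almost surely a path that witnesses reachability.
-/

open scoped ENNReal

/-! ### The path measure of a labelled Markov chain -/

namespace LabelledDTMC

variable {State AP : Type*} (M : LabelledDTMC State AP)

/-- The expected value of `f` after one step from `x`. -/
noncomputable def stepMean (f : State → ℝ≥0∞) (x : State) : ℝ≥0∞ := ∑' y, M.step x y * f y

theorem lintegral_stepKernel (f : State → ℝ≥0∞) (x : State) :
    ∫⁻ y, f y ∂(M.stepKernel x) = M.stepMean f x := by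
  let _ : MeasurableSpace State := ⊤
  change ∫⁻ y, f y ∂((M.step x).toMeasure) = M.stepMean f x
  rw [← PMF.restrict_toMeasure_support, lintegral_countable _ (M.step x).support_countable,
    stepMean, ← tsum_subtype_eq_of_support_subset (s := (M.step x).support)]
  · refine tsum_congr fun y => ?_
    rw [PMF.toMeasure_apply_singleton _ _ (MeasurableSet.singleton _), mul_comm]
  · intro y hy
    rw [PMF.mem_support_iff]
    exact left_ne_zero_of_mul hy

/-- The Markov property of the path measure, for functions of product form. -/
theorem lintegral_prod_mul_succ (s : State) (n : ℕ) (u : ℕ → State → ℝ≥0∞)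
    (f : State → ℝ≥0∞) :
    ∫⁻ σ, (∏ i ∈ Finset.Iic n, u i (σ i)) * f (σ (n + 1)) ∂(M.pathMeasure s) =
      ∫⁻ σ, (∏ i ∈ Finset.Iic n, u i (σ i)) * M.stepMean f (σ n) ∂(M.pathMeasure s) := by
  let _ : MeasurableSpace State := ⊤
  have := M.isMarkovKernel_stepKernel
  set κ : (n : ℕ) → Kernel ((i : Finset.Iic n) → State) State := fun n =>
    M.stepKernel.comap (fun x : (i : Finset.Iic n) → State => x ⟨n, Finset.mem_Iic.2 le_rfl⟩)
      (measurable_pi_apply _)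
  change ∫⁻ σ, _ ∂(Kernel.traj (X := fun _ : ℕ => State) κ 0 (fun _ => s)) =
    ∫⁻ σ, _ ∂(Kernel.traj (X := fun _ : ℕ => State) κ 0 (fun _ => s))
  have hm : ∀ g : State → ℝ≥0∞, Measurable g := fun g => measurable_from_top
  set G : ((i : Finset.Iic n) → State) → ℝ≥0∞ := fun x => ∏ i : Finset.Iic n, u i (x i)
  have hGm : Measurable G :=
    Finset.measurable_prod _ fun i _ => (hm (u i)).comp (measurable_pi_apply i)
  have hGσ : ∀ σ : ℕ → State, ∏ i ∈ Finset.Iic n, u i (σ i) =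
      G (Preorder.frestrictLe (π := fun _ : ℕ => State) n σ) := fun σ =>
    (Finset.prod_coe_sort (Finset.Iic n) fun i => u i (σ i)).symm
  have key := Kernel.partialTraj_compProd_eq_map_traj (X := fun _ : ℕ => State) (κ := κ)
    (Nat.zero_le n) (x₀ := fun _ => s)
  have hF : Measurable fun p : ((i : Finset.Iic n) → State) × State => G p.1 * f p.2 :=
    (hGm.comp measurable_fst).mul ((hm f).comp measurable_snd)
  have h1 : ∫⁻ σ, (∏ i ∈ Finset.Iic n, u i (σ i)) * f (σ (n + 1))
      ∂(Kernel.traj (X := fun _ : ℕ => State) κ 0 (fun _ => s)) =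
      ∫⁻ p, G p.1 * f p.2 ∂((Kernel.traj (X := fun _ : ℕ => State) κ 0 (fun _ => s)).map
        (fun x ↦ (Preorder.frestrictLe (π := fun _ : ℕ => State) n x, x (n + 1)))) := by
    rw [lintegral_map hF (by fun_prop)]
    simp only [hGσ]
  rw [h1, ← key, Measure.lintegral_compProd hF,
    ← Kernel.traj_map_frestrictLe_apply, lintegral_map _ (by fun_prop)]
  · refine lintegral_congr fun σ => ?_
    rw [hGσ]
    change ∫⁻ b, G (Preorder.frestrictLe (π := fun _ : ℕ => State) n σ) * f b
      ∂(κ n (Preorder.frestrictLe (π := fun _ : ℕ => State) n σ)) = _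
    rw [lintegral_const_mul _ (hm f)]
    congr 1
    exact M.lintegral_stepKernel f (σ n)
  · exact hF.lintegral_kernel_prod_right'

theorem lintegral_eval_zero_pathMeasure (s : State) (f : State → ℝ≥0∞) :
    ∫⁻ σ, f (σ 0) ∂(M.pathMeasure s) = f s := by
  let _ : MeasurableSpace State := ⊤
  have := M.isMarkovKernel_stepKernel
  set κ : (n : ℕ) → Kernel ((i : Finset.Iic n) → State) State := fun n =>
    M.stepKernel.comap (fun x : (i : Finset.Iic n) → State => x ⟨n, Finset.mem_Iic.2 le_rfl⟩)
      (measurable_pi_apply _)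
  change ∫⁻ σ, _ ∂(Kernel.traj (X := fun _ : ℕ => State) κ 0 (fun _ => s)) = _
  have hm : Measurable fun x : (i : Finset.Iic 0) → State => f (x ⟨0, by simp⟩) :=
    (measurable_from_top (f := f)).comp (measurable_pi_apply _)
  have key := Kernel.traj_map_frestrictLe_apply (X := fun _ : ℕ => State) (κ := κ) 0 0 (fun _ => s)
  rw [Kernel.partialTraj_self, Kernel.id_apply] at key
  have h1 := lintegral_map (μ := Kernel.traj (X := fun _ : ℕ => State) κ 0 (fun _ => s)) hm
    (Preorder.measurable_frestrictLe (X := fun _ : ℕ => State) 0)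
  rw [key, lintegral_dirac' _ hm] at h1
  exact h1.symm

/-- The operator whose `n`-th iterate at `f` gives the expectation of `f (σ n)` on the paths `σ`
that stay in `A` before time `n`. -/
noncomputable def killedMean (A : Set State) (f : State → ℝ≥0∞) : State → ℝ≥0∞ :=
  A.indicator (M.stepMean f)

theorem lintegral_prod_indicator_mul (s : State) (A : Set State) (n : ℕ) (f : State → ℝ≥0∞) :
    ∫⁻ σ, (∏ i ∈ Finset.range n, A.indicator 1 (σ i)) * f (σ n) ∂(M.pathMeasure s) =
      (M.killedMean A)^[n] f s := by
  induction n generalizing f with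
  | zero => simpa using M.lintegral_eval_zero_pathMeasure s f
  | succ n ih =>
    rw [Function.iterate_succ_apply, ← ih]
    have h := M.lintegral_prod_mul_succ s n (fun _ => A.indicator 1) f
    rw [← Nat.range_succ_eq_Iic] at h
    rw [h]
    refine lintegral_congr fun σ => ?_
    rw [Finset.prod_range_succ, mul_assoc]
    congr 1
    by_cases hA : σ n ∈ A <;> simp [killedMean, hA]

theorem measurableSet_eval_preimage (n : ℕ) (B : Set State) :
    @MeasurableSet (ℕ → State) (@MeasurableSpace.pi ℕ (fun _ => State) (fun _ => ⊤))
      {σ | σ n ∈ B} :=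
  let _ : MeasurableSpace State := ⊤
  (measurable_pi_apply (X := fun _ : ℕ => State) n) (MeasurableSpace.measurableSet_top (s := B))

theorem measurableSet_box (A B : Set State) (n : ℕ) :
    @MeasurableSet (ℕ → State) (@MeasurableSpace.pi ℕ (fun _ => State) (fun _ => ⊤))
      {σ | (∀ i < n, σ i ∈ A) ∧ σ n ∈ B} := by
  let _ : MeasurableSpace State := ⊤
  have : {σ : ℕ → State | (∀ i < n, σ i ∈ A) ∧ σ n ∈ B} =
      (⋂ i, ⋂ (_ : i < n), {σ | σ i ∈ A}) ∩ {σ | σ n ∈ B} := by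
    ext σ; simp
  rw [this]
  exact (MeasurableSet.iInter fun i => MeasurableSet.iInter fun _ =>
    measurableSet_eval_preimage i A).inter (measurableSet_eval_preimage n B)

theorem pathMeasure_box (s : State) (A B : Set State) (n : ℕ) :
    M.pathMeasure s {σ | (∀ i < n, σ i ∈ A) ∧ σ n ∈ B} =
      (M.killedMean A)^[n] (B.indicator 1) s := by
  rw [← lintegral_prod_indicator_mul, ← lintegral_indicator_one (measurableSet_box A B n)]
  refine lintegral_congr fun σ => ?_
  by_cases hB : σ n ∈ B
  · by_cases hA : ∀ i < n, σ i ∈ A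
    · rw [Finset.prod_congr rfl fun i hi => Set.indicator_of_mem (hA i (Finset.mem_range.1 hi)) _]
      simpa [hB, Set.indicator] using hA
    · have hA' := hA
      push Not at hA
      obtain ⟨i, hi, hiA⟩ := hA
      rw [Finset.prod_eq_zero (Finset.mem_range.2 hi) (Set.indicator_of_notMem hiA _)]
      simp [Set.indicator, hA']
  · simp [Set.indicator, hB]

/-- Even on an uncountable state space, almost every sequence is a path: at every time the chain
is almost surely in a countable set, and it almost surely leaves each point of this set along a
transition of positive probability. -/
theorem ae_mem_Paths (s : State) : ∀ᵐ σ ∂(M.pathMeasure s), σ ∈ M.Paths s := by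
  let _ : MeasurableSpace State := ⊤
  have hz : ∀ B : Set State, ∀ n, M.pathMeasure s {σ | σ n ∈ B} =
      ∫⁻ σ, B.indicator 1 (σ n) ∂(M.pathMeasure s) := fun B n => by
    rw [← lintegral_indicator_one (measurableSet_eval_preimage n B)]
    rfl
  have h0 : ∀ᵐ σ ∂(M.pathMeasure s), σ 0 = s := by
    have := hz {s}ᶜ 0
    rw [lintegral_eval_zero_pathMeasure] at this
    simpa [ae_iff] using this
  -- almost no path takes a transition of probability zero out of a given state
  have hstep : ∀ n (x : State), ∀ᵐ σ ∂(M.pathMeasure s),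
      σ n = x → 0 < M.step (σ n) (σ (n + 1)) := by
    intro n x
    have h := M.lintegral_prod_mul_succ s n
      (fun i => if i = n then ({x} : Set State).indicator 1 else 1)
      ({y | M.step x y = 0}.indicator 1)
    have hp : ∀ σ : ℕ → State, ∏ i ∈ Finset.Iic n,
        (if i = n then ({x} : Set State).indicator (1 : State → ℝ≥0∞) else 1) (σ i) =
        ({x} : Set State).indicator 1 (σ n) := fun σ => by
      rw [Finset.prod_eq_single_of_mem n (by simp)]
      · simp
      · intro i _ hi; simp [hi]
    simp only [hp] at h
    have hr : ∀ σ : ℕ → State, ({x} : Set State).indicator (1 : State → ℝ≥0∞) (σ n) *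
        M.stepMean ({y | M.step x y = 0}.indicator 1) (σ n) = 0 := fun σ => by
      by_cases hx : σ n = x
      · rw [hx, mul_eq_zero]; right
        refine ENNReal.tsum_eq_zero.2 fun y => ?_
        by_cases hy : M.step x y = 0 <;> simp [hy]
      · simp [hx]
    simp only [hr, lintegral_zero] at h
    have hme : Measurable fun σ : ℕ → State => ({x} : Set State).indicator (1 : State → ℝ≥0∞)
        (σ n) * {y | M.step x y = 0}.indicator (1 : State → ℝ≥0∞) (σ (n + 1)) :=
      ((measurable_from_top (f := ({x} : Set State).indicator (1 : State → ℝ≥0∞))).comp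
        (measurable_pi_apply n)).mul
      ((measurable_from_top (f := {y | M.step x y = 0}.indicator (1 : State → ℝ≥0∞))).comp
        (measurable_pi_apply (n + 1)))
    rw [lintegral_eq_zero_iff hme] at h
    filter_upwards [h] with σ hσ hx
    rw [pos_iff_ne_zero]
    intro hy
    rw [hx] at hy
    simp [hx, hy] at hσ
  have hsupp : ∀ n, ∃ T : Set State, T.Countable ∧ ∀ᵐ σ ∂(M.pathMeasure s), σ n ∈ T := by
    intro n
    induction n with
    | zero => exact ⟨{s}, Set.countable_singleton s, h0⟩
    | succ n ih =>
      obtain ⟨T, hT, hσT⟩ := ih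
      refine ⟨⋃ x ∈ T, (M.step x).support, hT.biUnion fun x _ => (M.step x).support_countable, ?_⟩
      have := (ae_ball_iff hT).2 fun x _ => hstep n x
      filter_upwards [hσT, this] with σ h1 h2
      exact Set.mem_biUnion h1 ((PMF.mem_support_iff _ _).2 (h2 _ h1 rfl).ne')
  have hall : ∀ n, ∀ᵐ σ ∂(M.pathMeasure s), 0 < M.step (σ n) (σ (n + 1)) := by
    intro n
    obtain ⟨T, hT, hσT⟩ := hsupp n
    have := (ae_ball_iff hT).2 fun x _ => hstep n x
    filter_upwards [hσT, this] with σ h1 h2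
    exact h2 _ h1 rfl
  filter_upwards [h0, ae_all_iff.2 hall] with σ h1 h2
  exact ⟨h1, h2⟩

theorem pathProb_eq (s : State) (E : Set (ℕ → State)) :
    M.pathProb s E = (M.pathMeasure s E).toReal := by
  rw [pathProb, Set.inter_comm, measure_inter_conull' ]
  exact measure_mono_null (fun σ hσ => hσ.2) (M.ae_mem_Paths s)

theorem pathProb_nxt (s : State) (Φ : StateFormula AP) :
    M.pathProb s {σ | M.PathSat (.nxt Φ) σ} =
      (M.killedMean Set.univ ({x | M.Sat Φ x}.indicator 1) s).toReal := by
  have := M.pathMeasure_box s Set.univ {x | M.Sat Φ x} 1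
  rw [Function.iterate_one] at this
  rw [pathProb_eq, ← this]
  congr 2
  ext σ
  simp [PathSat]

/-- The event `Φ U^{≤ k} Ψ` is split by the first time at which `Ψ` holds. -/
theorem pathProb_untl (s : State) (k : ℕ) (Φ Ψ : StateFormula AP) :
    M.pathProb s {σ | M.PathSat (.untl k Φ Ψ) σ} =
      (∑ h ∈ Finset.range (k + 1), (M.killedMean {x | M.Sat Φ x ∧ ¬ M.Sat Ψ x})^[h]
        ({x | M.Sat Ψ x}.indicator 1) s).toReal := by
  classical
  set A := {x | M.Sat Φ x ∧ ¬ M.Sat Ψ x} with hA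
  set B := {x | M.Sat Ψ x} with hB
  have hU : {σ | M.PathSat (.untl k Φ Ψ) σ} =
      ⋃ h ∈ Finset.range (k + 1), {σ : ℕ → State | (∀ i < h, σ i ∈ A) ∧ σ h ∈ B} := by
    ext σ
    simp only [PathSat, Set.mem_ofPred_eq, Set.mem_iUnion, Finset.mem_range, exists_prop]
    constructor
    · rintro ⟨h, hk, hΨ, hΦ⟩
      have hex : ∃ h, M.Sat Ψ (σ h) := ⟨h, hΨ⟩
      refine ⟨Nat.find hex, ?_, fun i hi => ⟨hΦ i ?_, Nat.find_min hex hi⟩, Nat.find_spec hex⟩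
      · exact lt_of_le_of_lt (Nat.find_min' hex hΨ) (Nat.lt_succ_of_le hk)
      · exact lt_of_lt_of_le hi (Nat.find_min' hex hΨ)
    · rintro ⟨h, hk, h1, h2⟩
      exact ⟨h, Nat.le_of_lt_succ hk, h2, fun i hi => (h1 i hi).1⟩
  rw [pathProb_eq, hU, measure_biUnion_finset]
  · simp only [pathMeasure_box]
  · intro h _ h' _ hne
    refine Set.disjoint_left.2 fun σ h1 h2 => ?_
    rcases lt_or_gt_of_ne hne with hlt | hlt
    · exact (h2.1 h hlt).2 h1.2
    · exact (h1.1 h' hlt).2 h2.2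
  · exact fun h _ => measurableSet_box A B h

end LabelledDTMC

/-! ### Chernoff bounds for independent objects -/

section ProductRows

variable {ι S : Type*} [Fintype ι] [DecidableEq ι] [Fintype S]

theorem sum_prod_mul_prod (Q g : ι → S → ℝ) :
    ∑ C : ι → S, (∏ n, Q n (C n)) * ∏ n, g n (C n) = ∏ n, ∑ c, Q n c * g n c := by
  simp only [← Finset.prod_mul_distrib]
  rw [Finset.prod_univ_sum, Fintype.piFinset_univ]

theorem sum_mul_exp_le {q y : S → ℝ} (hq : ∀ c, 0 ≤ q c) (hq1 : ∑ c, q c = 1)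
    (hy : ∀ c, |y c| ≤ 1) (hqy : ∑ c, q c * y c = 0) {a : ℝ} (ha : 0 ≤ a) (ha1 : a ≤ 1) :
    ∑ c, q c * Real.exp (a * y c) ≤ Real.exp (a ^ 2) := by
  have h1 : ∀ c, Real.exp (a * y c) ≤ 1 + a * y c + a ^ 2 := fun c => by
    have h2 : |a * y c| ≤ a := by
      rw [abs_mul, abs_of_nonneg ha]
      exact mul_le_of_le_one_right ha (hy c)
    have h3 := (abs_le.1 (Real.abs_exp_sub_one_sub_id_le (h2.trans ha1))).2
    have h4 : (a * y c) ^ 2 ≤ a ^ 2 := sq_le_sq' (by linarith [(abs_le.1 h2).1]) (abs_le.1 h2).2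
    linarith
  calc ∑ c, q c * Real.exp (a * y c) ≤ ∑ c, q c * (1 + a * y c + a ^ 2) :=
        Finset.sum_le_sum fun c _ => mul_le_mul_of_nonneg_left (h1 c) (hq c)
    _ = (1 + a ^ 2) * ∑ c, q c + a * ∑ c, q c * y c := by
        rw [Finset.mul_sum, Finset.mul_sum, ← Finset.sum_add_distrib]
        exact Finset.sum_congr rfl fun c _ => by ring
    _ ≤ Real.exp (a ^ 2) := by
        rw [hq1, hqy]
        linarith [Real.add_one_le_exp (a ^ 2)]

/-- A Chernoff bound for a sum of independent centred random variables with values in `[-1, 1]`,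
where `Q n` is the distribution on `S` of the argument of the `n`-th of them. -/
theorem sum_prod_filter_le_exp {Q y : ι → S → ℝ} (hQ : ∀ n c, 0 ≤ Q n c)
    (hQ1 : ∀ n, ∑ c, Q n c = 1) (hy : ∀ n c, |y n c| ≤ 1) (hQy : ∀ n, ∑ c, Q n c * y n c = 0)
    {ε : ℝ} (hε : 0 ≤ ε) (hε2 : ε ≤ 2) :
    ∑ C : ι → S, (if Fintype.card ι * ε ≤ ∑ n, y n (C n) then ∏ n, Q n (C n) else 0) ≤
      Real.exp (-(Fintype.card ι * (ε ^ 2 / 4))) := by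
  -- the exponent `a = ε / 2` minimises `a ^ 2 - a * ε`
  set a := ε / 2 with ha
  have hP : ∀ C : ι → S, 0 ≤ ∏ n, Q n (C n) := fun C => Finset.prod_nonneg fun n _ => hQ _ _
  have h1 : ∀ C : ι → S,
      (if Fintype.card ι * ε ≤ ∑ n, y n (C n) then ∏ n, Q n (C n) else 0) ≤
      Real.exp (-(a * (Fintype.card ι * ε))) *
        ((∏ n, Q n (C n)) * ∏ n, Real.exp (a * y n (C n))) := fun C => by
    rw [← Real.exp_sum, ← Finset.mul_sum, mul_left_comm, ← Real.exp_add]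
    split_ifs with h
    · refine le_mul_of_one_le_right (hP C) (Real.one_le_exp ?_)
      have := mul_le_mul_of_nonneg_left h (show 0 ≤ a by positivity)
      linarith
    · exact mul_nonneg (hP C) (Real.exp_pos _).le
  refine (Finset.sum_le_sum fun C _ => h1 C).trans ?_
  rw [← Finset.mul_sum, sum_prod_mul_prod Q fun n c => Real.exp (a * y n c)]
  have h2 : ∏ n, ∑ c, Q n c * Real.exp (a * y n c) ≤ ∏ _n : ι, Real.exp (a ^ 2) :=
    Finset.prod_le_prod
      (fun n _ => Finset.sum_nonneg fun c _ => mul_nonneg (hQ n c) (Real.exp_pos _).le)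
      fun n _ => sum_mul_exp_le (hQ n) (hQ1 n) (hy n) (hQy n) (by positivity) (by linarith)
  refine (mul_le_mul_of_nonneg_left h2 (Real.exp_pos _).le).trans ?_
  rw [← Real.exp_sum, ← Real.exp_add, Finset.sum_const, Finset.card_univ, nsmul_eq_mul]
  refine Real.exp_le_exp.2 (le_of_eq ?_)
  rw [ha]; ring

/-- The two-sided bound for the number of independent objects that are in state `c`. -/
theorem sum_prod_filter_abs_le_exp [DecidableEq S] {Q : ι → S → ℝ} (hQ : ∀ n c, 0 ≤ Q n c)
    (hQ1 : ∀ n, ∑ c, Q n c = 1) (c : S) {ε : ℝ} (hε : 0 ≤ ε) (hε2 : ε ≤ 2) :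
    ∑ C : ι → S, (if Fintype.card ι * ε ≤ |∑ n, ((if C n = c then 1 else 0) - Q n c)|
      then ∏ n, Q n (C n) else 0) ≤ 2 * Real.exp (-(Fintype.card ι * (ε ^ 2 / 4))) := by
  have hle : ∀ n, Q n c ≤ 1 := fun n => by
    rw [← hQ1 n]
    exact Finset.single_le_sum (fun d _ => hQ n d) (Finset.mem_univ c)
  set y : ι → S → ℝ := fun n d => (if d = c then 1 else 0) - Q n c with hy
  have hy1 : ∀ n d, |y n d| ≤ 1 := fun n d => by
    rw [abs_le]
    have := hQ n c
    have := hle n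
    simp only [hy]
    split_ifs <;> constructor <;> linarith
  have hy0 : ∀ n, ∑ d, Q n d * y n d = 0 := fun n => by
    simp [hy, mul_sub, Finset.sum_sub_distrib, ← Finset.sum_mul, hQ1]
  have h1 := sum_prod_filter_le_exp hQ hQ1 hy1 hy0 hε hε2
  have h2 := sum_prod_filter_le_exp (y := fun n d => - y n d) hQ hQ1
    (fun n d => by rw [abs_neg]; exact hy1 n d) (fun n => by simp [hy0]) hε hε2
  rw [two_mul]
  refine le_trans ?_ (add_le_add h1 h2)
  rw [← Finset.sum_add_distrib]
  refine Finset.sum_le_sum fun C _ => ?_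
  have hP : 0 ≤ ∏ n, Q n (C n) := Finset.prod_nonneg fun n _ => hQ _ _
  rw [Finset.sum_neg_distrib]
  by_cases h : Fintype.card ι * ε ≤ |∑ n, y n (C n)|
  · rw [if_pos h]
    rcases le_abs.1 h with h | h
    · rw [if_pos h]
      split_ifs <;> linarith
    · rw [if_pos h]
      split_ifs <;> linarith
  · rw [if_neg h]
    split_ifs <;> linarith

end ProductRows

/-! ### One step of a large population near a given occupancy measure -/

section Population

variable {S Act : Type*} [Fintype S] [DecidableEq S] [Fintype Act] [DecidableEq Act]
  {Δ : ObjectSpec S Act}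

/-- The occupancy measure of the next state concentrates around its conditional mean. -/
theorem SystemSpec.sum_systemMatrix_filter_le_exp {N : ℕ} [NeZero N] (spec : SystemSpec Δ N)
    (C : Fin N → S) (c : S) {ε : ℝ} (hε : 0 ≤ ε) (hε2 : ε ≤ 2) :
    ∑ C', (if ε ≤ |(occupancy C').1 c - ∑ d, (occupancy C).1 d * spec.K (occupancy C) d c|
      then spec.systemMatrix C C' else 0) ≤ 2 * Real.exp (-(N * (ε ^ 2 / 4))) := by
  have hN : (0 : ℝ) < N := Nat.cast_pos.2 (NeZero.pos N)
  have h := sum_prod_filter_abs_le_exp (Q := fun n => spec.K (occupancy C) (C n))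
    (fun n => (spec.isStochastic_K _).nonneg _) (fun n => (spec.isStochastic_K _).row_sum _) c
    hε hε2
  rw [Fintype.card_fin] at h
  refine le_trans (le_of_eq (Finset.sum_congr rfl fun C' _ => if_congr ?_ rfl rfl)) h
  have hmean : ∑ d, (occupancy C).1 d * spec.K (occupancy C) d c =
      (1 / (N : ℝ)) * ∑ n, spec.K (occupancy C) (C n) c := by
    set k := fun d => spec.K (occupancy C) d c with hk
    change ∑ d, ((1 / (N : ℝ)) * ∑ n, if C n = d then 1 else 0) * k d = (1 / (N : ℝ)) * ∑ n, k (C n)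
    simp_rw [mul_assoc, ← Finset.mul_sum, Finset.sum_mul]
    rw [Finset.sum_comm]
    simp
  have hdiff : ∑ n, ((if C' n = c then (1 : ℝ) else 0) - spec.K (occupancy C) (C n) c) =
      N * ((occupancy C').1 c - ∑ d, (occupancy C).1 d * spec.K (occupancy C) d c) := by
    rw [hmean, Finset.sum_sub_distrib, mul_sub]
    change _ = (N : ℝ) * ((1 / (N : ℝ)) * ∑ n, if C' n = c then 1 else 0) - _
    field_simp
  rw [hdiff, abs_mul, abs_of_pos hN, mul_le_mul_iff_right₀ hN]

/-- The first object moves according to its own row of the object transition matrix. -/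
theorem SystemSpec.sum_systemMatrix_mul_first {N : ℕ} [NeZero N] (spec : SystemSpec Δ N)
    (C : Fin N → S) (h : S → ℝ) :
    ∑ C', spec.systemMatrix C C' * h (C' 0) = ∑ c, spec.K (occupancy C) (C 0) c * h c := by
  have h1 := sum_prod_mul_prod (fun n => spec.K (occupancy C) (C n))
    (fun n : Fin N => if n = 0 then h else 1)
  have h2 : ∀ C' : Fin N → S, ∏ n, (if n = 0 then h else 1) (C' n) = h (C' 0) := fun C' => by
    rw [Finset.prod_eq_single_of_mem 0 (Finset.mem_univ _)]
    · simp
    · intro n _ hn; simp [hn]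
  simp only [h2] at h1
  refine h1.trans ?_
  rw [Finset.prod_eq_single_of_mem 0 (Finset.mem_univ _)]
  · simp
  · intro n _ hn; simp [hn, (spec.isStochastic_K _).row_sum]

/-- The filter on global states of all sizes in which the number of objects tends to infinity
while the occupancy measure tends to `m`. -/
noncomputable def largeNear (m : stdSimplex ℝ S) : Filter (Σ N : ℕ+, (Fin N → S)) :=
  comap (fun x => (x.1, occupancy x.2)) (atTop ×ˢ 𝓝 m)

theorem eventually_largeNear {m : stdSimplex ℝ S} {p : (Σ N : ℕ+, (Fin N → S)) → Prop} :
    (∀ᶠ x in largeNear m, p x) ↔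
      ∃ U ∈ 𝓝 m, ∀ᶠ N in atTop, ∀ C : Fin (N : ℕ+) → S, occupancy C ∈ U → p ⟨N, C⟩ := by
  rw [largeNear, eventually_comap, eventually_prod_iff]
  constructor
  · rintro ⟨pa, ha, pb, hb, h⟩
    exact ⟨{y | pb y}, hb, ha.mono fun N hN C hC => h hN hC _ rfl⟩
  · rintro ⟨U, hU, h⟩
    exact ⟨_, h, _, hU, fun {N} hN {y} hy ⟨N', C⟩ hx => by
      obtain ⟨rfl, rfl⟩ := Prod.mk.inj hx
      exact hN C hy⟩

theorem tendsto_size_largeNear (m : stdSimplex ℝ S) :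
    Tendsto (fun x : Σ N : ℕ+, (Fin N → S) => x.1) (largeNear m) atTop :=
  tendsto_fst.comp tendsto_comap

theorem tendsto_occupancy_largeNear (m : stdSimplex ℝ S) :
    Tendsto (fun x : Σ N : ℕ+, (Fin N → S) => occupancy x.2) (largeNear m) (𝓝 m) :=
  tendsto_snd.comp tendsto_comap

variable {spec : (N : ℕ+) → SystemSpec Δ N} {K : stdSimplex ℝ S → Matrix S S ℝ}

theorem tendsto_K_largeNear (hcont : ∀ c c', Continuous fun m => K m c c')
    (hlim : ∀ c c',
      TendstoUniformly (fun (N : ℕ+) m => (spec N).K m c c') (fun m => K m c c') atTop)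
    (m : stdSimplex ℝ S) (c c' : S) :
    Tendsto (fun x : Σ N : ℕ+, (Fin N → S) => (spec x.1).K (occupancy x.2) c c') (largeNear m)
      (𝓝 (K m c c')) := by
  rw [Metric.tendsto_nhds]
  intro ε hε
  have h1 := (tendsto_size_largeNear m).eventually
    (Metric.tendstoUniformly_iff.1 (hlim c c') (ε / 2) (half_pos hε))
  have h2 := Metric.tendsto_nhds.1 (((hcont c c').tendsto m).comp (tendsto_occupancy_largeNear m))
    (ε / 2) (half_pos hε)
  filter_upwards [h1, h2] with x hx1 hx2
  calc dist _ _ ≤ _ := dist_triangle_left _ _ (K (occupancy x.2) c c')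
    _ < ε / 2 + ε / 2 := add_lt_add (hx1 _) hx2
    _ = ε := add_halves ε

theorem tendsto_coord_largeNear (m : stdSimplex ℝ S) (c : S) :
    Tendsto (fun x : Σ N : ℕ+, (Fin N → S) => (occupancy x.2).1 c) (largeNear m) (𝓝 (m.1 c)) :=
  (((continuous_apply c).comp continuous_subtype_val).tendsto m).comp
    (tendsto_occupancy_largeNear m)

open Classical in
/-- From occupancy measures near `m`, the next occupancy measure is near `m · K(m)` except with a
probability that is exponentially small in the number of objects. -/
theorem exists_sum_systemMatrix_filter_le (hcont : ∀ c c', Continuous fun m => K m c c')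
    (hlim : ∀ c c',
      TendstoUniformly (fun (N : ℕ+) m => (spec N).K m c c') (fun m => K m c c') atTop)
    (hK : ∀ m, IsStochastic (K m)) (m : stdSimplex ℝ S) {U : Set (stdSimplex ℝ S)}
    (hU : U ∈ 𝓝 (meanFieldStep K hK m)) :
    ∃ r > 0, ∀ᶠ x in largeNear m,
      ∑ C', (if occupancy C' ∈ U then 0 else (spec x.1).systemMatrix x.2 C') ≤
        Fintype.card S * (2 * Real.exp (-(((x.1 : ℕ) : ℝ) * r))) := by
  obtain ⟨δ, hδ, hball⟩ := Metric.mem_nhds_iff.1 hU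
  set ε := min (δ / 2) 1 with hε
  have hε0 : 0 < ε := lt_min (half_pos hδ) one_pos
  refine ⟨ε ^ 2 / 4, by positivity, ?_⟩
  have hmean : ∀ c, ∀ᶠ x in largeNear m,
      |∑ d, (occupancy x.2).1 d * (spec x.1).K (occupancy x.2) d c -
        (meanFieldStep K hK m).1 c| < δ / 2 := fun c => by
    have : Tendsto (fun x : Σ N : ℕ+, (Fin N → S) =>
        ∑ d, (occupancy x.2).1 d * (spec x.1).K (occupancy x.2) d c) (largeNear m)
        (𝓝 (∑ d, m.1 d * K m d c)) :=
      tendsto_finsetSum _ fun d _ =>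
        (tendsto_coord_largeNear m d).mul (tendsto_K_largeNear hcont hlim m d c)
    exact Metric.tendsto_nhds.1 this _ (half_pos hδ)
  filter_upwards [eventually_all.2 hmean] with x hx
  have h1 : ∀ C', (if occupancy C' ∈ U then 0 else (spec x.1).systemMatrix x.2 C') ≤
      ∑ c, if ε ≤ |(occupancy C').1 c - ∑ d, (occupancy x.2).1 d * (spec x.1).K (occupancy x.2) d c|
        then (spec x.1).systemMatrix x.2 C' else 0 := fun C' => by
    have hw := (spec x.1).isStochastic_systemMatrix.nonneg x.2 C'
    have hnn : ∀ c, 0 ≤ if ε ≤ |(occupancy C').1 c -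
        ∑ d, (occupancy x.2).1 d * (spec x.1).K (occupancy x.2) d c|
        then (spec x.1).systemMatrix x.2 C' else 0 := fun c => by split_ifs <;> simp [hw]
    split_ifs with hC
    · exact Finset.sum_nonneg fun c _ => hnn c
    · have hd : ∃ c, δ ≤ |(occupancy C').1 c - (meanFieldStep K hK m).1 c| := by
        by_contra! hcon
        refine hC (hball ?_)
        rw [Metric.mem_ball, Subtype.dist_eq, dist_pi_lt_iff hδ]
        exact hcon
      obtain ⟨c, hc⟩ := hd
      refine le_trans ?_ (Finset.single_le_sum (fun c _ => hnn c) (Finset.mem_univ c))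
      rw [if_pos]
      have h2 := abs_sub_le ((occupancy C').1 c)
        (∑ d, (occupancy x.2).1 d * (spec x.1).K (occupancy x.2) d c)
        ((meanFieldStep K hK m).1 c)
      have h3 := hx c
      have h4 : ε ≤ δ / 2 := min_le_left _ _
      linarith
  refine (Finset.sum_le_sum fun C' _ => h1 C').trans ?_
  rw [Finset.sum_comm]
  refine (Finset.sum_le_card_nsmul _ _ _ fun c _ =>
    (spec x.1).sum_systemMatrix_filter_le_exp x.2 c hε0.le ?_).trans ?_
  · linarith [min_le_right (δ / 2) 1]
  · rw [Finset.card_univ, nsmul_eq_mul]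

/-- Functions that, near `m · K(m)`, are asymptotically functions `h` of the state of the first
object have one-step means that, near `m`, are asymptotically the means of `h` under `K(m)`. -/
theorem tendsto_mean_largeNear (hcont : ∀ c c', Continuous fun m => K m c c')
    (hlim : ∀ c c',
      TendstoUniformly (fun (N : ℕ+) m => (spec N).K m c c') (fun m => K m c c') atTop)
    (hK : ∀ m, IsStochastic (K m)) (m : stdSimplex ℝ S)
    {g : (N : ℕ+) → (Fin N → S) → ℝ} {h : S → ℝ} (hg : ∀ N C c, |g N C - h c| ≤ 1)
    (hgh : Tendsto (fun x : Σ N : ℕ+, (Fin N → S) => g x.1 x.2 - h (x.2 0))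
      (largeNear (meanFieldStep K hK m)) (𝓝 0)) :
    Tendsto (fun x : Σ N : ℕ+, (Fin N → S) =>
      ∑ C', (spec x.1).systemMatrix x.2 C' * g x.1 C' - ∑ c, K m (x.2 0) c * h c)
      (largeNear m) (𝓝 0) := by
  classical
  have hmain : Tendsto (fun x : Σ N : ℕ+, (Fin N → S) =>
      ∑ C', (spec x.1).systemMatrix x.2 C' * (g x.1 C' - h (C' 0))) (largeNear m) (𝓝 0) := by
    rw [Metric.tendsto_nhds]
    intro ε hε
    obtain ⟨U, hU, hUN⟩ := eventually_largeNear.1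
      (Metric.tendsto_nhds.1 hgh (ε / 2) (half_pos hε))
    obtain ⟨r, hr, hbad⟩ := exists_sum_systemMatrix_filter_le hcont hlim hK m hU
    have hexp : Tendsto (fun x : Σ N : ℕ+, (Fin N → S) =>
        Fintype.card S * (2 * Real.exp (-(((x.1 : ℕ) : ℝ) * r)))) (largeNear m) (𝓝 0) := by
      have h1 : Tendsto (fun x : Σ N : ℕ+, (Fin N → S) => ((x.1 : ℕ) : ℝ) * r)
          (largeNear m) atTop :=
        ((tendsto_natCast_atTop_atTop.comp
          (tendsto_comp_val_Ioi_atTop.2 tendsto_id)).comp (tendsto_size_largeNear m)).atTop_mul_const hr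
      have h2 := Real.tendsto_exp_neg_atTop_nhds_zero.comp h1
      simpa using (h2.const_mul 2).const_mul (Fintype.card S : ℝ)
    filter_upwards [hbad, (tendsto_size_largeNear m).eventually hUN,
      hexp.eventually (gt_mem_nhds (half_pos hε))] with x hx1 hx2 hx3
    rw [Real.dist_eq, sub_zero]
    have hstoch := (spec x.1).isStochastic_systemMatrix
    calc |∑ C', (spec x.1).systemMatrix x.2 C' * (g x.1 C' - h (C' 0))|
        ≤ ∑ C', |(spec x.1).systemMatrix x.2 C' * (g x.1 C' - h (C' 0))| :=
          Finset.abs_sum_le_sum_abs _ _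
      _ ≤ ∑ C', ((spec x.1).systemMatrix x.2 C' * (ε / 2) +
          if occupancy C' ∈ U then 0 else (spec x.1).systemMatrix x.2 C') := by
        refine Finset.sum_le_sum fun C' _ => ?_
        have hw := hstoch.nonneg x.2 C'
        rw [abs_mul, abs_of_nonneg hw]
        split_ifs with hC
        · have := hx2 C' hC
          rw [Real.dist_eq, sub_zero] at this
          rw [add_zero]
          exact mul_le_mul_of_nonneg_left this.le hw
        · have := mul_le_mul_of_nonneg_left (hg x.1 C' (C' 0)) hw
          have := mul_nonneg hw (half_pos hε).le
          linarith
      _ = ε / 2 + ∑ C', (if occupancy C' ∈ U then 0 else (spec x.1).systemMatrix x.2 C') := by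
        rw [Finset.sum_add_distrib, ← Finset.sum_mul, hstoch.row_sum, one_mul]
      _ < ε := by linarith
  have hfirst : Tendsto (fun x : Σ N : ℕ+, (Fin N → S) =>
      ∑ C', (spec x.1).systemMatrix x.2 C' * h (C' 0) - ∑ c, K m (x.2 0) c * h c)
      (largeNear m) (𝓝 0) := by
    -- the row is that of the current state of the first object, one of finitely many
    have h1 : Tendsto (fun x : Σ N : ℕ+, (Fin N → S) =>
        ∑ d, ∑ c, |(spec x.1).K (occupancy x.2) d c - K m d c| * |h c|) (largeNear m) (𝓝 0) := by
      have : ∑ d : S, ∑ c : S, |K m d c - K m d c| * |h c| = 0 := by simp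
      rw [← this]
      exact tendsto_finsetSum _ fun d _ => tendsto_finsetSum _ fun c _ =>
        (((tendsto_K_largeNear hcont hlim m d c).sub_const _).abs).mul_const _
    refine squeeze_zero_norm (fun x => ?_) h1
    rw [Real.norm_eq_abs, SystemSpec.sum_systemMatrix_mul_first, ← Finset.sum_sub_distrib]
    refine (Finset.abs_sum_le_sum_abs _ _).trans ?_
    simp only [← sub_mul, abs_mul]
    exact Finset.single_le_sum
      (f := fun d => ∑ c, |(spec x.1).K (occupancy x.2) d c - K m d c| * |h c|)
      (fun d _ => Finset.sum_nonneg fun c _ => by positivity) (Finset.mem_univ (x.2 0))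
  have := hmain.add hfirst
  rw [add_zero] at this
  refine this.congr fun x => ?_
  simp only [mul_sub, Finset.sum_sub_distrib]
  ring

end Population

/-! ### Transfer of formulas to the limit chain -/

section FormulaConvergence

theorem LabelledDTMC.stepMean_le_one {State AP : Type*} (M : LabelledDTMC State AP)
    {f : State → ℝ≥0∞} (hf : ∀ x, f x ≤ 1) (x : State) : M.stepMean f x ≤ 1 := by
  rw [← (M.step x).tsum_coe]
  exact ENNReal.tsum_le_tsum fun y => mul_le_of_le_one_right' (hf y)

theorem LabelledDTMC.iterate_killedMean_le_one {State AP : Type*} (M : LabelledDTMC State AP)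
    (A B : Set State) (h : ℕ) (x : State) : (M.killedMean A)^[h] (B.indicator 1) x ≤ 1 := by
  induction h generalizing x with
  | zero => exact Set.indicator_le_self' (fun _ _ => zero_le_one) x
  | succ h ih =>
    rw [Function.iterate_succ_apply']
    exact (Set.indicator_le_self' (fun _ _ => zero_le) x).trans (M.stepMean_le_one ih x)

theorem LabelledDTMC.iterate_killedMean_ne_top {State AP : Type*} (M : LabelledDTMC State AP)
    (A B : Set State) (h : ℕ) (x : State) : (M.killedMean A)^[h] (B.indicator 1) x ≠ ∞ :=
  ne_top_of_le_ne_top ENNReal.one_ne_top (M.iterate_killedMean_le_one A B h x)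

theorem Cmp.holds_iff_of_abs_sub_lt (b : Cmp) {x y p : ℝ} (h : |x - y| < |y - p|) :
    b.Holds x p ↔ b.Holds y p := by
  rcases lt_or_ge (y - p) 0 with hy | hy
  · rw [abs_of_neg hy] at h
    have := (abs_lt.1 h).2
    cases b <;> simp only [Cmp.Holds] <;> constructor <;> intro _ <;> linarith
  · rw [abs_of_nonneg hy] at h
    have := (abs_lt.1 h).1
    have := (abs_nonneg (x - y)).trans_lt h
    cases b <;> simp only [Cmp.Holds] <;> constructor <;> intro _ <;> linarith

theorem StateFormula.self_mem_subformulas {AP : Type*} (Φ : StateFormula AP) :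
    Φ ∈ Φ.subformulas := by
  cases Φ <;> simp [StateFormula.subformulas]

variable {S AP₁ APg : Type*} [Fintype S]

theorem toReal_stepMean_limitChain {K : stdSimplex ℝ S → Matrix S S ℝ}
    (hK : ∀ m, IsStochastic (K m)) (c₀ : S) (μ₀ : stdSimplex ℝ S) (ℓ : Labelling S AP₁ APg)
    {f : S × stdSimplex ℝ S → ℝ≥0∞} (hf : ∀ x, f x ≤ 1) (c : S) (m : stdSimplex ℝ S) :
    ((limitChain K hK c₀ μ₀ ℓ).stepMean f (c, m)).toReal =
      ∑ c', K m c c' * (f (c', meanFieldStep K hK m)).toReal := by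
  classical
  have h1 : (limitChain K hK c₀ μ₀ ℓ).stepMean f (c, m) =
      ∑ c', ENNReal.ofReal (K m c c') * f (c', meanFieldStep K hK m) := by
    change ∑' y, (((hK m).row c).map fun c' => (c', meanFieldStep K hK m)) y * f y = _
    simp only [PMF.map_apply, ← ENNReal.tsum_mul_right]
    rw [ENNReal.tsum_comm, tsum_fintype]
    refine Finset.sum_congr rfl fun c' _ => ?_
    rw [tsum_eq_single (c', meanFieldStep K hK m)]
    · rw [if_pos rfl]; rfl
    · intro y hy; rw [if_neg hy, zero_mul]
  rw [h1, ENNReal.toReal_sum]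
  · refine Finset.sum_congr rfl fun c' _ => ?_
    rw [ENNReal.toReal_mul, ENNReal.toReal_ofReal ((hK m).nonneg c c')]
  · exact fun c' _ => ENNReal.mul_ne_top ENNReal.ofReal_ne_top
      (ne_top_of_le_ne_top ENNReal.one_ne_top (hf _))

theorem BExp.continuous_value (e : BExp S) : Continuous e.value := by
  refine e.continuousOn.comp_continuous
    (continuous_pi fun j => (continuous_apply (e.args j)).comp continuous_subtype_val)
    fun m => ⟨fun j => m.2.1 _, fun j => ?_⟩
  change m.1 (e.args j) ≤ 1
  rw [← m.2.2]
  exact Finset.single_le_sum (fun c _ => m.2.1 c) (Finset.mem_univ _)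

theorem BExp.eventually_holds_iff (e : BExp S) {m : stdSimplex ℝ S} (h : e.value m ≠ e.r) :
    ∀ᶠ m' in 𝓝 m, e.Holds m' ↔ e.Holds m := by
  have ht := e.continuous_value.tendsto m
  rcases lt_or_gt_of_ne h with h | h
  · filter_upwards [ht.eventually (gt_mem_nhds h)] with m' hm'
    unfold BExp.Holds
    split_ifs <;> constructor <;> intro _ <;> linarith
  · filter_upwards [ht.eventually (lt_mem_nhds h)] with m' hm'
    unfold BExp.Holds
    split_ifs <;> constructor <;> intro _ <;> linarith

/-- The hypotheses under which a formula can be transferred, for a set `F` of formulas that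
includes all the relevant subformulas: no probability in the limit chain is equal to its threshold
on the mean field, and from time `t` on the mean field avoids the boundaries of the global
propositions. -/
structure Transferable (M : LabelledDTMC (S × stdSimplex ℝ S) (AP₁ ⊕ APg))
    (ℓ : Labelling S AP₁ APg) (μ : ℕ → stdSimplex ℝ S) (t : ℕ)
    (F : Set (StateFormula (AP₁ ⊕ APg))) : Prop where
  safe : ∀ b p φ, .prob b p φ ∈ F → ∀ c s, M.pathProb (c, μ s) {σ | M.PathSat φ σ} ≠ p
  boundary : ∀ a : APg, .atom (.inr a) ∈ F → ∀ s ≥ t, (ℓ.glob a).value (μ s) ≠ (ℓ.glob a).r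

theorem Transferable.mono {M : LabelledDTMC (S × stdSimplex ℝ S) (AP₁ ⊕ APg)}
    {ℓ : Labelling S AP₁ APg} {μ : ℕ → stdSimplex ℝ S} {t : ℕ}
    {F G : Set (StateFormula (AP₁ ⊕ APg))} (h : Transferable M ℓ μ t G) (hFG : F ⊆ G) :
    Transferable M ℓ μ t F :=
  ⟨fun b p φ hF => h.safe b p φ (hFG hF), fun a hF => h.boundary a (hFG hF)⟩

variable {Act : Type*} [DecidableEq S] [Fintype Act] [DecidableEq Act] {Δ : ObjectSpec S Act}

theorem SystemSpec.toReal_stepMean_fullChain {N : ℕ} [NeZero N] (spec : SystemSpec Δ N)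
    (ℓ : Labelling S AP₁ APg) {f : (Fin N → S) → ℝ≥0∞} (hf : ∀ C, f C ≤ 1) (C : Fin N → S) :
    ((spec.fullChain ℓ).stepMean f C).toReal =
      ∑ C', spec.systemMatrix C C' * (f C').toReal := by
  rw [LabelledDTMC.stepMean, tsum_fintype, ENNReal.toReal_sum]
  · refine Finset.sum_congr rfl fun C' _ => ?_
    rw [ENNReal.toReal_mul]
    congr 1
    exact ENNReal.toReal_ofReal (spec.isStochastic_systemMatrix.nonneg C C')
  · exact fun C' _ => ENNReal.mul_ne_top (PMF.apply_ne_top _ _)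
      (ne_top_of_le_ne_top ENNReal.one_ne_top (hf C'))

variable {spec : (N : ℕ+) → SystemSpec Δ N} {K : stdSimplex ℝ S → Matrix S S ℝ}

/-- The probabilities of being in `A` before time `h` and in `B` at time `h` converge along the mean
field to those of the limit chain, if the sets correspond near the mean field from time `t` on. The
induction on `h` is over all starting times `s ≥ t`, because one step leads from `s` to `s + 1`. -/
theorem tendsto_iterate_killedMean (ℓ : Labelling S AP₁ APg)
    (hcont : ∀ c c', Continuous fun m => K m c c')
    (hlim : ∀ c c',
      TendstoUniformly (fun (N : ℕ+) m => (spec N).K m c c') (fun m => K m c c') atTop)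
    (hK : ∀ m, IsStochastic (K m)) (c₀ : S) (μ₀ : stdSimplex ℝ S) {t : ℕ}
    {A' B' : (N : ℕ+) → Set (Fin N → S)} {A B : Set (S × stdSimplex ℝ S)}
    (hA : ∀ s ≥ t, ∀ᶠ x in largeNear (meanField K hK μ₀ s),
      x.2 ∈ A' x.1 ↔ (x.2 0, meanField K hK μ₀ s) ∈ A)
    (hB : ∀ s ≥ t, ∀ᶠ x in largeNear (meanField K hK μ₀ s),
      x.2 ∈ B' x.1 ↔ (x.2 0, meanField K hK μ₀ s) ∈ B)
    (h s : ℕ) (hs : t ≤ s) :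
    Tendsto (fun x : Σ N : ℕ+, (Fin N → S) =>
      ((((spec x.1).fullChain ℓ).killedMean (A' x.1))^[h] ((B' x.1).indicator 1) x.2).toReal -
      (((limitChain K hK c₀ μ₀ ℓ).killedMean A)^[h] (B.indicator 1)
        (x.2 0, meanField K hK μ₀ s)).toReal) (largeNear (meanField K hK μ₀ s)) (𝓝 0) := by
  induction h generalizing s with
  | zero =>
    refine tendsto_const_nhds.congr' ?_
    filter_upwards [hB s hs] with x hx
    by_cases hxB : x.2 ∈ B' x.1
    · simp [hxB, hx.1 hxB]
    · simp [hxB, mt hx.2 hxB]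
  | succ h ih =>
    have hstep := tendsto_mean_largeNear hcont hlim hK (meanField K hK μ₀ s)
      (g := fun N C =>
        ((((spec N).fullChain ℓ).killedMean (A' N))^[h] ((B' N).indicator 1) C).toReal)
      (h := fun c => (((limitChain K hK c₀ μ₀ ℓ).killedMean A)^[h] (B.indicator 1)
        (c, meanField K hK μ₀ (s + 1))).toReal) (fun N C c => ?_) (ih (s + 1) (hs.trans s.le_succ))
    · refine squeeze_zero_norm' ?_ (tendsto_norm_zero.comp hstep)
      filter_upwards [hA s hs] with x hx
      simp only [Function.iterate_succ_apply', LabelledDTMC.killedMean, Function.comp]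
      by_cases hxA : x.2 ∈ A' x.1
      · rw [Set.indicator_of_mem hxA, Set.indicator_of_mem (hx.1 hxA),
          (spec x.1).toReal_stepMean_fullChain ℓ
            (LabelledDTMC.iterate_killedMean_le_one _ _ _ _),
          toReal_stepMean_limitChain hK c₀ μ₀ ℓ
            (LabelledDTMC.iterate_killedMean_le_one _ _ _ _)]
        exact le_rfl
      · rw [Set.indicator_of_notMem hxA, Set.indicator_of_notMem (mt hx.2 hxA)]
        simp
    · have h1 := ENNReal.toReal_mono ENNReal.one_ne_top
        (((spec N).fullChain ℓ).iterate_killedMean_le_one (A' N) (B' N) h C)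
      have h2 := ENNReal.toReal_mono ENNReal.one_ne_top
        ((limitChain K hK c₀ μ₀ ℓ).iterate_killedMean_le_one A B h
          (c, meanField K hK μ₀ (s + 1)))
      rw [ENNReal.toReal_one] at h1 h2
      have h3 := ENNReal.toReal_nonneg (a :=
        (((spec N).fullChain ℓ).killedMean (A' N))^[h] ((B' N).indicator 1) C)
      have h4 := ENNReal.toReal_nonneg (a := ((limitChain K hK c₀ μ₀ ℓ).killedMean A)^[h]
        (B.indicator 1) (c, meanField K hK μ₀ (s + 1)))
      exact abs_le.2 ⟨by linarith, by linarith⟩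

variable {ℓ : Labelling S AP₁ APg}

mutual

/-- Near a point of the mean field, the truth of a formula in a large population depends only on
the state of the first object. -/
theorem eventually_sat_iff (hcont : ∀ c c', Continuous fun m => K m c c')
    (hlim : ∀ c c',
      TendstoUniformly (fun (N : ℕ+) m => (spec N).K m c c') (fun m => K m c c') atTop)
    (hK : ∀ m, IsStochastic (K m)) (c₀ : S) (μ₀ : stdSimplex ℝ S) (t : ℕ) :
    (Φ : StateFormula (AP₁ ⊕ APg)) →
    Transferable (limitChain K hK c₀ μ₀ ℓ) ℓ (meanField K hK μ₀) t Φ.subformulas →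
    ∀ s ≥ t, ∀ᶠ x in largeNear (meanField K hK μ₀ s), ((spec x.1).fullChain ℓ).Sat Φ x.2 ↔
      (limitChain K hK c₀ μ₀ ℓ).Sat Φ (x.2 0, meanField K hK μ₀ s)
  | .atom (.inl a), _, s, _ => by
    refine Eventually.of_forall fun x => ?_
    simp [LabelledDTMC.Sat, SystemSpec.fullChain, limitChain, Labelling.labels]
  | .atom (.inr a), hΦ, s, hs => by
    filter_upwards [(tendsto_occupancy_largeNear _).eventually ((ℓ.glob a).eventually_holds_iff
      (hΦ.boundary a (StateFormula.self_mem_subformulas _) s hs))] with x hx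
    simpa [LabelledDTMC.Sat, SystemSpec.fullChain, limitChain, Labelling.labels] using hx
  | .neg Φ, hΦ, s, hs => by
    filter_upwards [eventually_sat_iff hcont hlim hK c₀ μ₀ t Φ
      (hΦ.mono Set.subset_union_right) s hs] with x hx
    simpa only [LabelledDTMC.Sat] using not_congr hx
  | .or Φ Ψ, hΦ, s, hs => by
    filter_upwards [eventually_sat_iff hcont hlim hK c₀ μ₀ t Φ
        (hΦ.mono (Set.subset_union_left.trans Set.subset_union_right)) s hs,
      eventually_sat_iff hcont hlim hK c₀ μ₀ t Ψ
        (hΦ.mono (Set.subset_union_right.trans Set.subset_union_right)) s hs] with x h1 h2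
    simpa only [LabelledDTMC.Sat] using or_congr h1 h2
  | .prob b p φ, hΦ, s, hs => by
    have ht := tendsto_pathProb hcont hlim hK c₀ μ₀ t φ (hΦ.mono Set.subset_union_right) s hs
    have hc : ∀ c : S, 0 < |(limitChain K hK c₀ μ₀ ℓ).pathProb (c, meanField K hK μ₀ s)
        {σ | (limitChain K hK c₀ μ₀ ℓ).PathSat φ σ} - p| := fun c =>
      abs_pos.2 (sub_ne_zero.2 (hΦ.safe b p φ (StateFormula.self_mem_subformulas _) c s))
    filter_upwards [eventually_all.2 fun c => Metric.tendsto_nhds.1 ht _ (hc c)] with x hx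
    have := hx (x.2 0)
    rw [Real.dist_eq, sub_zero] at this
    simpa only [LabelledDTMC.Sat] using b.holds_iff_of_abs_sub_lt this

/-- Near a point of the mean field, the probability of a path formula in a large population is
asymptotically its probability in the limit chain, given the state of the first object. -/
theorem tendsto_pathProb (hcont : ∀ c c', Continuous fun m => K m c c')
    (hlim : ∀ c c',
      TendstoUniformly (fun (N : ℕ+) m => (spec N).K m c c') (fun m => K m c c') atTop)
    (hK : ∀ m, IsStochastic (K m)) (c₀ : S) (μ₀ : stdSimplex ℝ S) (t : ℕ) :
    (φ : PathFormula (AP₁ ⊕ APg)) →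
    Transferable (limitChain K hK c₀ μ₀ ℓ) ℓ (meanField K hK μ₀) t φ.subformulas →
    ∀ s ≥ t, Tendsto (fun x : Σ N : ℕ+, (Fin N → S) =>
      ((spec x.1).fullChain ℓ).pathProb x.2 {σ | ((spec x.1).fullChain ℓ).PathSat φ σ} -
      (limitChain K hK c₀ μ₀ ℓ).pathProb (x.2 0, meanField K hK μ₀ s)
        {σ | (limitChain K hK c₀ μ₀ ℓ).PathSat φ σ}) (largeNear (meanField K hK μ₀ s)) (𝓝 0)
  | .nxt Φ, hφ, s, hs => by
    have h1 := eventually_sat_iff hcont hlim hK c₀ μ₀ t Φ hφ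
    simp only [LabelledDTMC.pathProb_nxt]
    exact tendsto_iterate_killedMean ℓ hcont hlim hK c₀ μ₀ (A' := fun _ => Set.univ)
      (A := Set.univ) (B' := fun N => {C | ((spec N).fullChain ℓ).Sat Φ C})
      (B := {y | (limitChain K hK c₀ μ₀ ℓ).Sat Φ y}) (fun s _ => by simp) h1 1 s hs
  | .untl k Φ Ψ, hφ, s, hs => by
    have h1 := eventually_sat_iff hcont hlim hK c₀ μ₀ t Φ (hφ.mono Set.subset_union_left)
    have h2 := eventually_sat_iff hcont hlim hK c₀ μ₀ t Ψ (hφ.mono Set.subset_union_right)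
    have hsum := tendsto_finsetSum (Finset.range (k + 1)) fun h _ =>
      tendsto_iterate_killedMean ℓ hcont hlim hK c₀ μ₀
        (A' := fun N => {C | ((spec N).fullChain ℓ).Sat Φ C ∧ ¬ ((spec N).fullChain ℓ).Sat Ψ C})
        (A := {y | (limitChain K hK c₀ μ₀ ℓ).Sat Φ y ∧ ¬ (limitChain K hK c₀ μ₀ ℓ).Sat Ψ y})
        (B' := fun N => {C | ((spec N).fullChain ℓ).Sat Ψ C})
        (B := {y | (limitChain K hK c₀ μ₀ ℓ).Sat Ψ y})
        (fun s hs => by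
          filter_upwards [h1 s hs, h2 s hs] with x hx1 hx2
          exact and_congr hx1 (not_congr hx2)) h2 h s hs
    simp only [LabelledDTMC.pathProb_untl]
    rw [Finset.sum_const_zero] at hsum
    refine hsum.congr fun x => ?_
    rw [Finset.sum_sub_distrib,
      ENNReal.toReal_sum fun h _ => LabelledDTMC.iterate_killedMean_ne_top _ _ _ h _,
      ENNReal.toReal_sum fun h _ => LabelledDTMC.iterate_killedMean_ne_top _ _ _ h _]

end

end FormulaConvergence

/-! ### Realizations of finite chains -/

section Realizations

variable {State AP Ω : Type*} {M : LabelledDTMC State AP} [MeasurableSpace Ω]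
  {P : Measure Ω} {X : ℕ → Ω → State}

namespace LabelledDTMC.IsRealization

theorem measurableSet_history (hX : M.IsRealization P X) (t : ℕ) (x : ℕ → State) :
    MeasurableSet {ω | ∀ i ≤ t, X i ω = x i} := by
  have : {ω | ∀ i ≤ t, X i ω = x i} = ⋂ i, ⋂ (_ : i ≤ t), {ω | X i ω = x i} := by
    ext ω; simp
  rw [this]
  exact MeasurableSet.iInter fun i => MeasurableSet.iInter fun _ => hX.measurable i _

/-- The law of two consecutive states, by summation over the histories. -/
theorem measure_pair [Finite State] (hX : M.IsRealization P X) (t : ℕ) (s s' : State) :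
    P {ω | X t ω = s ∧ X (t + 1) ω = s'} = P {ω | X t ω = s} * M.step s s' := by
  classical
  have := Fintype.ofFinite State
  -- the sequence that continues the history `h` by `s` and `s'`
  obtain ⟨x, hx, hxt, hxt1⟩ : ∃ x : (Fin t → State) → ℕ → State,
      (∀ h (i : Fin t), x h i = h i) ∧ (∀ h, x h t = s) ∧ ∀ h, x h (t + 1) = s' :=
    ⟨fun h i => if hi : i < t then h ⟨i, hi⟩ else if i = t then s else s',
      by simp, by simp, by simp⟩
  have hhist : ∀ ω h, (∀ i < t, X i ω = x h i) ↔ (fun i : Fin t => X i ω) = h := fun ω h => by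
    refine ⟨fun hi => funext fun i => (hi i i.2).trans (hx h i), fun hi i hit => ?_⟩
    have := hx h ⟨i, hit⟩
    rw [← hi] at this ⊢
    exact this.symm
  have h1 : {ω | X t ω = s} = ⋃ h, {ω | ∀ i ≤ t, X i ω = x h i} := by
    ext ω
    simp only [Set.mem_ofPred_eq, Set.mem_iUnion]
    constructor
    · intro hs
      refine ⟨fun i => X i ω, fun i hi => ?_⟩
      rcases hi.lt_or_eq with hi | rfl
      · exact (hhist ω _).2 rfl i hi
      · exact hs.trans (hxt _).symm
    · rintro ⟨h, hh⟩
      rw [hh t le_rfl, hxt]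
  have h2 : {ω | X t ω = s ∧ X (t + 1) ω = s'} =
      ⋃ h, {ω | ∀ i ≤ t + 1, X i ω = x h i} := by
    ext ω
    simp only [Set.mem_ofPred_eq, Set.mem_iUnion]
    constructor
    · rintro ⟨hs, hs'⟩
      refine ⟨fun i => X i ω, fun i hi => ?_⟩
      rcases hi.lt_or_eq with hi | rfl
      · rcases (Nat.lt_succ_iff.1 hi).lt_or_eq with hi | rfl
        · exact (hhist ω _).2 rfl i hi
        · exact hs.trans (hxt _).symm
      · exact hs'.trans (hxt1 _).symm
    · rintro ⟨h, hh⟩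
      exact ⟨by rw [hh t t.le_succ, hxt], by rw [hh (t + 1) le_rfl, hxt1]⟩
  have hdisj : ∀ n ≥ t, Pairwise (Function.onFun Disjoint fun h => {ω | ∀ i ≤ n, X i ω = x h i}) :=
    fun n hn h h' hne => Set.disjoint_left.2 fun ω hω hω' => hne <| by
      rw [← (hhist ω h).1 fun i hi => hω i (hi.le.trans hn),
        ← (hhist ω h').1 fun i hi => hω' i (hi.le.trans hn)]
  rw [h1, h2, measure_iUnion (hdisj _ t.le_succ) fun h => hX.measurableSet_history _ _,
    measure_iUnion (hdisj _ le_rfl) fun h => hX.measurableSet_history _ _,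
    ← ENNReal.tsum_mul_right]
  refine tsum_congr fun h => ?_
  rw [hX.markov, hxt, hxt1]

theorem ae_step_pos [Finite State] (hX : M.IsRealization P X) :
    ∀ᵐ ω ∂P, ∀ t, 0 < M.step (X t ω) (X (t + 1) ω) := by
  refine ae_all_iff.2 fun t => ?_
  have h : ∀ s s', ∀ᵐ ω ∂P, X t ω = s → X (t + 1) ω = s' → 0 < M.step s s' := fun s s' => by
    rcases eq_or_ne (M.step s s') 0 with h0 | h0
    · have := hX.measure_pair t s s'
      rw [h0, mul_zero] at this
      have hn : ∀ᵐ ω ∂P, ¬ (X t ω = s ∧ X (t + 1) ω = s') := by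
        simpa [ae_iff] using this
      filter_upwards [hn] with ω hω h1 h2
      exact absurd ⟨h1, h2⟩ hω
    · exact Eventually.of_forall fun ω _ _ => pos_iff_ne_zero.2 h0
  filter_upwards [ae_all_iff.2 fun s => ae_all_iff.2 (h s)] with ω hω
  exact hω _ _ rfl rfl

/-- Almost every trajectory is itself a path from the initial state. -/
theorem ae_mem_reachable [Finite State] (hX : M.IsRealization P X) (t : ℕ) :
    ∀ᵐ ω ∂P, X t ω ∈ M.reachable t := by
  filter_upwards [hX.initial, hX.ae_step_pos] with ω h0 h1
  exact ⟨fun i => X i ω, ⟨h0, h1⟩, rfl⟩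

open Classical in
/-- A bound `ε` for the probability of a step into `B` that holds for each state of `G` bounds the
probability that the chain is in `G` at time `t` and then steps into `B`. -/
theorem measure_step_le [IsProbabilityMeasure P] [Fintype State] (hX : M.IsRealization P X)
    (t : ℕ) {G B : Set State} {ε : ℝ≥0∞}
    (hGB : ∀ s ∈ G, ∑ s', (if s' ∈ B then M.step s s' else 0) ≤ ε) :
    P {ω | X t ω ∈ G ∧ X (t + 1) ω ∈ B} ≤ ε := by
  have hsub : {ω | X t ω ∈ G ∧ X (t + 1) ω ∈ B} ⊆ ⋃ s, ⋃ s',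
      if s ∈ G ∧ s' ∈ B then {ω | X t ω = s ∧ X (t + 1) ω = s'} else ∅ := by
    rintro ω ⟨h1, h2⟩
    simp only [Set.mem_iUnion]
    exact ⟨X t ω, X (t + 1) ω, by simp [h1, h2]⟩
  have hone : ∑ s, P {ω | X t ω = s} = 1 := by
    rw [← tsum_fintype (L := .unconditional _), ← measure_iUnion]
    · rw [← measure_univ (μ := P)]
      congr 1
      ext ω; simp
    · exact fun s s' hne => Set.disjoint_left.2 fun ω h h' => hne (h.symm.trans h')
    · exact fun s => hX.measurable t s
  calc P {ω | X t ω ∈ G ∧ X (t + 1) ω ∈ B}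
      ≤ ∑ s, ∑ s', P (if s ∈ G ∧ s' ∈ B then {ω | X t ω = s ∧ X (t + 1) ω = s'} else ∅) :=
        (measure_mono hsub).trans <| (measure_iUnion_fintype_le P _).trans <|
          Finset.sum_le_sum fun s _ => measure_iUnion_fintype_le P _
    _ ≤ ∑ s, P {ω | X t ω = s} * ε := by
        refine Finset.sum_le_sum fun s _ => ?_
        by_cases hs : s ∈ G
        · refine le_trans (le_of_eq ?_) (mul_le_mul_right (hGB s hs) (P {ω | X t ω = s}))
          rw [Finset.mul_sum]
          refine Finset.sum_congr rfl fun s' _ => ?_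
          by_cases hs' : s' ∈ B
          · simp only [hs, hs', and_self, if_true]
            exact hX.measure_pair t s s'
          · simp [hs']
        · simp [hs]
    _ = ε := by rw [← Finset.sum_mul, hone, one_mul]

end LabelledDTMC.IsRealization

end Realizations

/-! ### Almost sure convergence to the mean field -/

section MeanFieldLimit

variable {S Act AP₁ APg Ω : Type*} [Fintype S] [DecidableEq S] [Fintype Act] [DecidableEq Act]
  {Δ : ObjectSpec S Act} {spec : (N : ℕ+) → SystemSpec Δ N} {K : stdSimplex ℝ S → Matrix S S ℝ}

theorem summable_const_mul_exp_neg_pnat (b : ℝ) {r : ℝ} (hr : 0 < r) :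
    Summable fun N : ℕ+ => b * (2 * Real.exp (-(((N : ℕ) : ℝ) * r))) := by
  have h1 : Summable fun n : ℕ => Real.exp ((n : ℝ) * (-r)) :=
    Real.summable_exp_nat_mul_iff.2 (neg_neg_of_pos hr)
  have h2 := ((h1.comp_injective PNat.coe_injective).mul_left 2).mul_left b
  simpa using h2

/-- The strong law of large numbers for the occupancy measures. No assumption on the joint law of
the processes is needed, because the tails are exponentially small and so the Borel–Cantelli lemma
applies to the one-step deviations. -/
theorem ae_eventually_occupancy_mem (ℓ : Labelling S AP₁ APg)
    (hcont : ∀ c c', Continuous fun m => K m c c')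
    (hlim : ∀ c c',
      TendstoUniformly (fun (N : ℕ+) m => (spec N).K m c c') (fun m => K m c c') atTop)
    (hK : ∀ m, IsStochastic (K m)) {μ₀ : stdSimplex ℝ S}
    (hinit : Tendsto (fun N : ℕ+ => occupancy (spec N).C₀) atTop (𝓝 μ₀))
    [MeasurableSpace Ω] {P : Measure Ω} [IsProbabilityMeasure P]
    {X : (N : ℕ+) → ℕ → Ω → (Fin N → S)} {N₀ : ℕ+}
    (hX : ∀ N ≥ N₀, ((spec N).fullChain ℓ).IsRealization P (X N)) (t : ℕ)
    {U : Set (stdSimplex ℝ S)} (hU : U ∈ 𝓝 (meanField K hK μ₀ t)) :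
    ∀ᵐ ω ∂P, ∀ᶠ N in atTop, occupancy (X N t ω) ∈ U := by
  classical
  induction t generalizing U with
  | zero =>
    have h0 : ∀ᵐ ω ∂P, ∀ N ≥ N₀, X N 0 ω = (spec N).C₀ :=
      ae_all_iff.2 fun N => eventually_imp_distrib_left.2 fun hN => (hX N hN).initial
    filter_upwards [h0] with ω hω
    filter_upwards [hinit.eventually hU, eventually_ge_atTop N₀] with N h1 h2
    rw [hω N h2]
    exact h1
  | succ t ih =>
    obtain ⟨r, hr, hbad⟩ := exists_sum_systemMatrix_filter_le hcont hlim hK _ hU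
    obtain ⟨V, hV, hVN⟩ := eventually_largeNear.1 hbad
    obtain ⟨N₁, hN₁⟩ := eventually_atTop.1 hVN
    set b : ℕ+ → ℝ := fun N => Fintype.card S * (2 * Real.exp (-(((N : ℕ) : ℝ) * r))) with hb
    let E : ℕ+ → Set Ω := fun N => if N₀ ≤ N ∧ N₁ ≤ N then
      {ω | X N t ω ∈ {C | occupancy C ∈ V} ∧ X N (t + 1) ω ∈ {C | occupancy C ∉ U}} else ∅
    have hE : ∀ N, P (E N) ≤ ENNReal.ofReal (b N) := fun N => by
      by_cases hN : N₀ ≤ N ∧ N₁ ≤ N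
      · simp only [E, if_pos hN]
        refine (hX N hN.1).measure_step_le t fun C hC => ?_
        refine le_trans (le_of_eq ?_) (ENNReal.ofReal_le_ofReal (hN₁ N hN.2 C hC))
        have hst := (spec N).isStochastic_systemMatrix.nonneg C
        rw [ENNReal.ofReal_sum_of_nonneg fun C' _ => by split_ifs <;> simp [hst]]
        refine Finset.sum_congr rfl fun C' _ => ?_
        by_cases hC' : occupancy C' ∈ U
        · simp [hC']
        · simp only [Set.mem_ofPred_eq, hC', not_false_eq_true, if_true, if_false]
          rfl
      · simp [E, hN]
    have hsum : ∑' N, P (E N) ≠ ∞ :=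
      ne_top_of_le_ne_top (summable_const_mul_exp_neg_pnat _ hr).tsum_ofReal_ne_top
        (ENNReal.tsum_le_tsum hE)
    filter_upwards [ae_finite_setOfPred_mem hsum, ih hV] with ω hfin hω
    obtain ⟨N₂, hN₂⟩ := hfin.bddAbove
    filter_upwards [hω, eventually_ge_atTop N₀, eventually_ge_atTop N₁,
      eventually_gt_atTop N₂] with N h1 h2 h3 h4
    by_contra hcon
    refine absurd (hN₂ (a := N) ?_) (not_le.2 h4)
    simp only [Set.mem_ofPred_eq, E, if_pos (And.intro h2 h3)]
    exact ⟨h1, hcon⟩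

end MeanFieldLimit

theorem mainTheorem2
    {S Act AP₁ APg Ω : Type*} [Fintype S] [DecidableEq S] [Fintype Act] [DecidableEq Act]
    -- a sequence of system specifications with the same first object
    (Δ : ObjectSpec S Act) (ℓ : Labelling S AP₁ APg)
    (spec : (N : ℕ+) → SystemSpec Δ N) (N₀ : ℕ+)
    (c₀ : S) (hfirst : ∀ N ≥ N₀, (spec N).C₀ 0 = c₀)
    -- uniform convergence of the object transition matrices to a continuous limit
    (K : stdSimplex ℝ S → Matrix S S ℝ)
    (hcont : ∀ c c', Continuous fun m => K m c c')
    (hlim : ∀ c c',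
      TendstoUniformly (fun (N : ℕ+) m => (spec N).K m c c') (fun m => K m c c') atTop)
    -- convergence of the initial occupancy measures
    (μ₀ : stdSimplex ℝ S)
    (hinit : Tendsto (fun N : ℕ+ => occupancy (spec N).C₀) atTop (𝓝 μ₀))
    -- the processes `X^(N)`, jointly on some probability space
    [MeasurableSpace Ω] (P : Measure Ω) [IsProbabilityMeasure P]
    (X : (N : ℕ+) → ℕ → Ω → (Fin N → S))
    (hX : ∀ N ≥ N₀, ((spec N).fullChain ℓ).IsRealization P (X N))
    -- a formula that is safe for the limit chain
    (Φ : StateFormula (AP₁ ⊕ APg))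
    (hsafe : (limitChain K (isStochastic_limit hlim) c₀ μ₀ ℓ).SafeOn
      {x | ∃ s, x.2 = meanField K (isStochastic_limit hlim) μ₀ s} Φ)
    (t : ℕ)
    -- the mean field is not on the boundary of a global proposition of the formula
    (hbdry : ∀ a : APg, .atom (.inr a) ∈ Φ.subformulas → ∀ s ≥ t,
      (ℓ.glob a).value (meanField K (isStochastic_limit hlim) μ₀ s) ≠ (ℓ.glob a).r) :
    ∀ᵐ ω ∂P, ∀ᶠ N in atTop,
      X N t ω ∈ ((spec N).fullChain ℓ).reachable t ∧
      (((spec N).fullChain ℓ).Sat Φ (X N t ω) ↔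
        (limitChain K (isStochastic_limit hlim) c₀ μ₀ ℓ).Sat Φ
          (X N t ω 0, meanField K (isStochastic_limit hlim) μ₀ t)) := by
  set hK := isStochastic_limit hlim
  have hΦ : Transferable (limitChain K hK c₀ μ₀ ℓ) ℓ (meanField K hK μ₀) t Φ.subformulas :=
    ⟨fun b p φ hφ c s => hsafe b p φ hφ (c, meanField K hK μ₀ s) ⟨s, rfl⟩, hbdry⟩
  obtain ⟨U, hU, hUN⟩ :=
    eventually_largeNear.1 (eventually_sat_iff hcont hlim hK c₀ μ₀ t Φ hΦ t le_rfl)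
  have hreach : ∀ᵐ ω ∂P, ∀ N ≥ N₀, X N t ω ∈ ((spec N).fullChain ℓ).reachable t :=
    ae_all_iff.2 fun N => eventually_imp_distrib_left.2 fun hN => (hX N hN).ae_mem_reachable t
  filter_upwards [ae_eventually_occupancy_mem ℓ hcont hlim hK hinit hX t hU, hreach]
    with ω hω hr
  filter_upwards [hω, hUN, eventually_ge_atTop N₀] with N h1 h2 h3
  exact ⟨hr N h3, h2 _ h1⟩
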